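/- **Setting.** An $n$-qubit state is a density matrix (positive semidefinite, trace $1$) on $(\mathbb C^2)^{\otimes n}$; it is pure if it has rank $1$, and symmetric if it is invariant under all permutations of the $n$ qubits. Let $PU(2)=U(2)/\{\lambda\,\mathrm{Id}:|\lambda|=1\}$. The local unitary (LU) group $PU(2)^n$ acts on states by $U\cdot\rho=U\rho U^\dagger=(g_1\otimes\cdots\otimes g_n)\,\rho\,(g_1\otimes\cdots\otimes g_n)^\dagger$ for $U=(g_1,\dots,g_n)$. Two states are LU equivalent if they lie in the same orbit, and $\mathrm{Stab}_\rho=\{U\in PU(2)^n: U\rho U^\dagger=\rho\}$. $X,Z$ are the Pauli matrices, $|D_n^{(k)}\rangle$ is the normalized equal superposition of the $n$-bit basis states with exactly $k$ ones, and in every semidirect product below $\mathbb Z_2$ acts by inversion. **Theorem 3.** Let $\rho$ be an $n$-qubit symmetric pure state whose stabilizer $\mathrm{Stab}_\rho$ is infinite. Then exactly one of the following kinds (i)–(ivb) occurs, meaning that $\rho$ is LU equivalent to a state $\tau=|\psi\rangle\langle\psi|$ of that kind. For every $\tau$ in the list the displayed formula is well defined and gives a group isomorphism onto the full stabilizer $\mathrm{Stab}_\tau$;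 hence, if $\rho=U\tau U^\dagger$, following it with conjugation by $U$ gives an isomorphism onto $\mathrm{Stab}_\rho$. LU classes are counted among symmetric pure states with $n$ fixed. - (i) Product state, $n\ge1$: $|\psi\rangle=|0\cdots0\rangle$, $U(1)^n\cong\mathrm{Stab}_\tau$ by $$(e^{it_1},\dots,e^{it_n})\mapsto(\exp(-it_1Z/2),\dots,\exp(-it_nZ/2)).$$ There is one LU class of this type. - (iia) GHZ state, $n\ge3$: $|\psi\rangle=\frac1{\sqrt2}(|0\cdots0\rangle+|1\cdots1\rangle)$, $U(1)^{n-1}\rtimes\mathbb Z_2\cong\mathrm{Stab}_\tau$ by $$(e^{it_1},\dots,e^{it_{n-1}},b)\mapsto\Big(\exp(-it_1Z/2),\dots,\exp(-it_{n-1}Z/2),\exp\big(i(\textstyle\sum_kt_k)Z/2\big)\Big)\cdot(X,\dots,X)^b.$$ There is one LU class of this type. - (iib) Generalized GHZ states, $n\ge2$: $|\psi\rangle=a|0\cdots0\rangle+b|1\cdots1\rangle$ with $a,b\in\mathbb C\setminus\{0\}$, $|a|^2+|b|^2=1$, $|a|\ne|b|$; $U(1)^{n-1}\cong\mathrm{Stab}_\tau$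 by $$(e^{it_1},\dots,e^{it_{n-1}})\mapsto\Big(\exp(-it_1Z/2),\dots,\exp(-it_{n-1}Z/2),\exp\big(i(\textstyle\sum_kt_k)Z/2\big)\Big).$$ Up to LU equivalence one may take $a,b$ real with $a>b>0$. The LU classes of this type are parameterized bijectively by $0<t<1$ through $a=\cos\frac\pi4t$, $b=\sin\frac\pi4t$. - (iii) Singlet state, $n=2$: $|\psi\rangle=\frac1{\sqrt2}(|01\rangle-|10\rangle)$, $PU(2)\cong\mathrm{Stab}_\tau$ by $g\mapsto(g,g)$. There is one LU class of this type. - (iva) Balanced Dicke state, $n\ge4$ even: $|\psi\rangle=|D_n^{(n/2)}\rangle$, $U(1)\rtimes\mathbb Z_2\cong\mathrm{Stab}_\tau$ by $$(e^{it},b)\mapsto(\exp(-itZ/2),\dots,\exp(-itZ/2))\cdot(X,\dots,X)^b.$$ There is one LU class of this type. - (ivb) Dicke states, $n\ge3$, $0<k<n$, $k\ne n/2$: $|\psi\rangle=|D_n^{(k)}\rangle$, $U(1)\cong\mathrm{Stab}_\tau$ by $$e^{it}\mapsto(\exp(-itZ/2),\dots,\exp(-itZ/2)).$$ There are exactly $\lfloor(n-1)/2\rfloor$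 LU classes of this type, with pairwise inequivalent representatives $|D_n^{(1)}\rangle,\dots,|D_n^{(\lfloor(n-1)/2\rfloor)}\rangle$. -/

import Mathlib

namespace LUStab

open Matrix Complex
open scoped ComplexOrder

/-! ### States of `n` qubits -/

/-- Complex `2^n × 2^n` matrices; rows and columns are indexed by bit strings of length `n`. -/
abbrev QMatrix (n : ℕ) : Type := Matrix (Fin n → Fin 2) (Fin n → Fin 2) ℂ

/-- State vectors of `n` qubits, written in the computational basis. -/
abbrev Ket (n : ℕ) : Type := (Fin n → Fin 2) → ℂ

/-- The matrix `|ψ⟩⟨ψ|`. -/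
def proj {n : ℕ} (ψ : Ket n) : QMatrix n := Matrix.vecMulVec ψ (star ψ)

/-- Density matrices: positive semidefinite with trace one. -/
def IsDensity {n : ℕ} (ρ : QMatrix n) : Prop := ρ.PosSemidef ∧ ρ.trace = 1

/-- Pure states: density matrices of rank one. -/
def IsPure {n : ℕ} (ρ : QMatrix n) : Prop := IsDensity ρ ∧ ρ.rank = 1

/-- Symmetric states: invariance under every permutation of the qubits. -/
def IsSymmetric {n : ℕ} (ρ : QMatrix n) : Prop :=
  ∀ π : Equiv.Perm (Fin n), ρ.submatrix (fun I => I ∘ π) (fun I => I ∘ π) = ρ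

/-! ### The local unitary group and its action -/

/-- The unitary group `U(2)`. -/
abbrev U2 : Type := Matrix.unitaryGroup (Fin 2) ℂ

/-- The subgroup of scalar matrices in `U(2)` (the scalar then automatically has modulus one). -/
def phases : Subgroup U2 where
  carrier := {g | ∃ c : ℂ, (g : Matrix (Fin 2) (Fin 2) ℂ) = c • 1}
  one_mem' := ⟨1, by simp⟩
  mul_mem' := by
    rintro a b ⟨c, hc⟩ ⟨d, hd⟩
    exact ⟨c * d, by rw [Matrix.UnitaryGroup.mul_val, hc, hd]; simp [smul_smul, mul_comm]⟩
  inv_mem' := by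
    rintro a ⟨c, hc⟩
    exact ⟨star c, by rw [Matrix.UnitaryGroup.inv_val, hc]; simp⟩

instance phases_normal : phases.Normal where
  conj_mem := by
    rintro a ⟨c, hc⟩ g
    refine ⟨c, ?_⟩
    have h : g * a * g⁻¹ = a := by
      have : g * a = a * g := by
        apply Subtype.ext
        simp [hc]
      rw [this, mul_inv_cancel_right]
    rw [h, hc]

/-- The projective unitary group `PU(2)`. -/
abbrev PU2 : Type := U2 ⧸ phases

/-- The local unitary group `PU(2)^n`. -/
abbrev LU (n : ℕ) : Type := Fin n → PU2

/-- The tensor product `g₁ ⊗ ⋯ ⊗ gₙ`. -/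
def tensor {n : ℕ} (g : Fin n → U2) : QMatrix n :=
  Matrix.of fun I J => ∏ k, (g k : Matrix (Fin 2) (Fin 2) ℂ) (I k) (J k)

/-- `(g₁ ⊗ ⋯ ⊗ gₙ) ρ (g₁ ⊗ ⋯ ⊗ gₙ)†`. -/
def conjBy {n : ℕ} (g : Fin n → U2) (ρ : QMatrix n) : QMatrix n :=
  tensor g * ρ * (tensor g)ᴴ

/-- The class in `PU(2)^n` of an element of `U(2)^n`. -/
def toLU {n : ℕ} (g : Fin n → U2) : LU n := fun k => (QuotientGroup.mk (g k) : PU2)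

/-- The action of `PU(2)^n` on matrices, through arbitrary representatives in `U(2)^n`
(`act_toLU` shows that their choice does not matter). -/
noncomputable def act {n : ℕ} (U : LU n) (ρ : QMatrix n) : QMatrix n :=
  conjBy (fun k => (U k).out) ρ

theorem tensor_mul {n : ℕ} (g h : Fin n → U2) : tensor (g * h) = tensor g * tensor h := by
  ext I J
  simp only [tensor, Matrix.of_apply, Matrix.mul_apply, Pi.mul_apply,
    Matrix.UnitaryGroup.mul_val]
  rw [Finset.prod_univ_sum, Fintype.piFinset_univ]
  simp [Finset.prod_mul_distrib]

theorem tensor_one {n : ℕ} : tensor (1 : Fin n → U2) = 1 := by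
  ext I J
  simp only [tensor, Matrix.of_apply, Pi.one_apply, Matrix.UnitaryGroup.one_val,
    Matrix.one_apply]
  by_cases h : I = J
  · simp [h]
  · rw [if_neg h]
    obtain ⟨k, hk⟩ := Function.ne_iff.mp h
    exact Finset.prod_eq_zero (Finset.mem_univ k) (by simp [hk])

theorem conjBy_mul {n : ℕ} (g h : Fin n → U2) (ρ : QMatrix n) :
    conjBy (g * h) ρ = conjBy g (conjBy h ρ) := by
  simp [conjBy, tensor_mul, Matrix.conjTranspose_mul, Matrix.mul_assoc]

theorem conjBy_one {n : ℕ} (ρ : QMatrix n) : conjBy 1 ρ = ρ := by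
  simp [conjBy, tensor_one]

theorem conjBy_phases {n : ℕ} (p : Fin n → U2) (hp : ∀ k, p k ∈ phases) (ρ : QMatrix n) :
    conjBy p ρ = ρ := by
  choose c hc using hp
  have ht : tensor p = (∏ k, c k) • (1 : QMatrix n) := by
    rw [← tensor_one]
    ext I J
    simp [tensor, hc, Finset.prod_mul_distrib]
  have hcc : ∀ k, c k * star (c k) = 1 := by
    intro k
    have h := Matrix.mem_unitaryGroup_iff.mp (p k).2
    rw [hc k] at h
    have h00 := congrFun (congrFun h 0) 0
    simpa [Matrix.star_eq_conjTranspose, mul_comm] using h00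
  have hprod : (∏ k, c k) * star (∏ k, c k) = 1 := by
    rw [star_prod, ← Finset.prod_mul_distrib]
    exact Finset.prod_eq_one fun k _ => hcc k
  rw [conjBy, ht, Matrix.conjTranspose_smul, Matrix.conjTranspose_one, Matrix.smul_mul,
    Matrix.one_mul, Matrix.mul_smul, Matrix.mul_one, smul_smul, mul_comm, hprod, one_smul]

/-- The action does not depend on the representatives. -/
theorem act_toLU {n : ℕ} (g : Fin n → U2) (ρ : QMatrix n) : act (toLU g) ρ = conjBy g ρ := by
  have h : (fun k => (toLU g k).out) = g * fun k => (g k)⁻¹ * (toLU g k).out := by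
    funext k; simp
  rw [act, h, conjBy_mul, conjBy_phases _ _ ρ]
  intro k
  rw [← QuotientGroup.eq]
  exact (Quotient.out_eq' (toLU g k)).symm

theorem toLU_out {n : ℕ} (U : LU n) : toLU (fun k => (U k).out) = U := by
  funext k
  exact Quotient.out_eq' (U k)

theorem act_mul {n : ℕ} (U V : LU n) (ρ : QMatrix n) : act (U * V) ρ = act U (act V ρ) := by
  have h : U * V = toLU ((fun k => (U k).out) * fun k => (V k).out) := by
    conv_lhs => rw [← toLU_out U, ← toLU_out V]
    rfl
  rw [h, act_toLU, conjBy_mul]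
  rfl

theorem act_one {n : ℕ} (ρ : QMatrix n) : act 1 ρ = ρ := by
  have h : (1 : LU n) = toLU 1 := rfl
  rw [h, act_toLU, conjBy_one]

/-- The local unitary stabilizer of `ρ`. -/
noncomputable def stab {n : ℕ} (ρ : QMatrix n) : Subgroup (LU n) where
  carrier := {U | act U ρ = ρ}
  one_mem' := act_one ρ
  mul_mem' := by
    intro U V hU hV
    simp only [Set.mem_ofPred_eq] at *
    rw [act_mul, hV, hU]
  inv_mem' := by
    intro U hU
    simp only [Set.mem_ofPred_eq] at *
    conv_lhs => rw [← hU]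
    rw [← act_mul, inv_mul_cancel, act_one]

/-- Local unitary equivalence. -/
def LUEquiv {n : ℕ} (ρ ρ' : QMatrix n) : Prop := ∃ U : LU n, act U ρ = ρ'

/-- The LU equivalence class of `ρ` among the pure symmetric states. -/
def luClass {n : ℕ} (ρ : QMatrix n) : Set (QMatrix n) :=
  {ρ' | IsPure ρ' ∧ IsSymmetric ρ' ∧ LUEquiv ρ ρ'}

/-! ### The special states -/

/-- `|0⋯0⟩`. -/
def productKet (n : ℕ) : Ket n := Pi.single 0 1

/-- `a|0⋯0⟩ + b|1⋯1⟩`. -/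
def ghzKet (n : ℕ) (a b : ℂ) : Ket n := Pi.single 0 a + Pi.single 1 b

/-- The normalized singlet `(|01⟩ - |10⟩)/√2`. -/
noncomputable def singletKet : Ket 2 :=
  ((1 / √2 : ℝ) : ℂ) • (Pi.single ![0, 1] 1 - Pi.single ![1, 0] 1)

/-- The Dicke state `|D_n^{(k)}⟩`: the normalized equal superposition of all bit strings of
length `n` that contain exactly `k` ones. -/
noncomputable def dickeKet (n k : ℕ) : Ket n := fun I =>
  if ∑ j, (I j : ℕ) = k then ((1 / √(n.choose k : ℝ) : ℝ) : ℂ) else 0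

/-- The six kinds of normal forms. -/
inductive Family : Type
  | product
  | ghz
  | genGHZ
  | singlet
  | dickeHalf
  | dicke

/-- The singlet state, present for two qubits only. -/
def singletStates : (n : ℕ) → Set (QMatrix n)
  | 2 => {proj singletKet}
  | _ => ∅

/-- The normal forms of each kind on `n` qubits. -/
def normalForms (n : ℕ) : Family → Set (QMatrix n)
  | .product => {proj (productKet n)}
  | .ghz => {τ | 3 ≤ n ∧ τ = proj (ghzKet n ((1 / √2 : ℝ) : ℂ) ((1 / √2 : ℝ) : ℂ))}
  | .genGHZ => {τ | 2 ≤ n ∧ ∃ a b : ℂ, a ≠ 0 ∧ b ≠ 0 ∧ ‖a‖ ≠ ‖b‖ ∧ ‖a‖ ^ 2 + ‖b‖ ^ 2 = 1 ∧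
      τ = proj (ghzKet n a b)}
  | .singlet => singletStates n
  | .dickeHalf => {τ | 4 ≤ n ∧ Even n ∧ τ = proj (dickeKet n (n / 2))}
  | .dicke => {τ | 3 ≤ n ∧ ∃ k : ℕ, 0 < k ∧ k < n ∧ 2 * k ≠ n ∧ τ = proj (dickeKet n k)}

/-- `ρ` is LU equivalent to a normal form of the given kind. -/
def OfFamily {n : ℕ} (F : Family) (ρ : QMatrix n) : Prop :=
  ∃ τ ∈ normalForms n F, LUEquiv τ ρ

/-- The LU equivalence classes of pure symmetric `n`-qubit states of the given kind. -/
def luClasses (n : ℕ) (F : Family) : Set (Set (QMatrix n)) :=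
  luClass '' {ρ : QMatrix n | IsPure ρ ∧ IsSymmetric ρ ∧ OfFamily F ρ}

/-! ### The groups and their embeddings -/

/-- Pauli `Z`. -/
def pauliZ : Matrix (Fin 2) (Fin 2) ℂ := !![1, 0; 0, -1]

/-- Pauli `X`. -/
def pauliX : Matrix (Fin 2) (Fin 2) ℂ := !![0, 1; 1, 0]

theorem exp_pauliZ (t : ℝ) :
    NormedSpace.exp ((-(Complex.I * t / 2)) • pauliZ) =
      !![Complex.exp (-(Complex.I * t / 2)), 0; 0, Complex.exp (Complex.I * t / 2)] := by
  have h : (-(Complex.I * t / 2)) • pauliZ =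
      Matrix.diagonal ![-(Complex.I * t / 2), Complex.I * t / 2] := by
    ext i j
    fin_cases i <;> fin_cases j <;> simp [pauliZ]
  rw [h, Matrix.exp_diagonal]
  ext i j
  fin_cases i <;> fin_cases j <;> simp [Pi.coe_exp, Complex.exp_eq_exp_ℂ]

/-- The unitary `exp(-itZ/2)`. -/
noncomputable def rotZ (t : ℝ) : U2 :=
  ⟨NormedSpace.exp ((-(Complex.I * t / 2)) • pauliZ), by
    rw [exp_pauliZ, Matrix.mem_unitaryGroup_iff]
    ext i j
    fin_cases i <;> fin_cases j <;>
      simp [Matrix.mul_apply, Matrix.star_apply, ← Complex.exp_conj, ← Complex.exp_add,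
        Complex.conj_ofNat, neg_div]⟩

/-- Pauli `X` as an element of `U(2)`. -/
def flipX : U2 :=
  ⟨pauliX, by
    rw [Matrix.mem_unitaryGroup_iff]
    ext i j
    fin_cases i <;> fin_cases j <;> simp [pauliX, Matrix.mul_apply, Matrix.star_apply]⟩

/-- `(exp(-it₁Z/2), …, exp(-itₙZ/2))`. -/
noncomputable def rotEach {n : ℕ} (t : Fin n → ℝ) : LU n := toLU fun k => rotZ (t k)

/-- `(exp(-it₁Z/2), …, exp(-itₙ₋₁Z/2), exp(i(∑ tₖ)Z/2))`. -/
noncomputable def rotBalanced {n : ℕ} (t : Fin (n - 1) → ℝ) : LU n :=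
  toLU fun k => if h : (k : ℕ) < n - 1 then rotZ (t ⟨k, h⟩) else rotZ (-∑ j, t j)

/-- `(exp(-itZ/2), …, exp(-itZ/2))`. -/
noncomputable def rotAll (n : ℕ) (t : ℝ) : LU n := toLU fun _ => rotZ t

/-- `(X, …, X)`. -/
def flipAll (n : ℕ) : LU n := toLU fun _ => flipX

/-- `Z₂`, written multiplicatively. -/
abbrev Z2 : Type := Multiplicative (ZMod 2)

/-- The action of `Z₂` on a commutative group by inversion. -/
def invAction (A : Type) [CommGroup A] : Z2 →* MulAut A where
  toFun b := if b = 1 then 1 else MulEquiv.inv A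
  map_one' := by simp
  map_mul' := by
    have h : (MulEquiv.inv A : MulAut A) * MulEquiv.inv A = 1 := by
      ext x; simp
    have h2 : ∀ b : Z2, b = 1 ∨ b = Multiplicative.ofAdd 1 := by decide
    have h3 : (Multiplicative.ofAdd 1 : Z2) ≠ 1 := by decide
    have h4 : (Multiplicative.ofAdd 1 : Z2) * Multiplicative.ofAdd 1 = 1 := by decide
    intro b c
    rcases h2 b with rfl | rfl <;> rcases h2 c with rfl | rfl <;> simp [h3, h4, h]

/-- The dihedral extension `A ⋊ Z₂`, where `Z₂` inverts `A`. -/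
abbrev Dih (A : Type) [CommGroup A] : Type := A ⋊[invAction A] Z2

/-- The exponent `0` or `1` of an element of `Z₂`. -/
def bit (b : Z2) : ℕ := (Multiplicative.toAdd b).val

/-- The element `param p` of `G` corresponds to `img p` under an isomorphism of `G` onto the
full stabilizer of `τ`, and following this by conjugation with `U` gives an isomorphism onto
the full stabilizer of the LU equivalent state `UτU†`. -/
def StabilizerIso {n : ℕ} (G : Type) [Group G] {P : Type} (param : P → G) (img : P → LU n)
    (τ : QMatrix n) : Prop :=
  ∃ e : G ≃* stab τ, (∀ p, (e (param p) : LU n) = img p) ∧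
    ∀ U : LU n, ∃ e' : G ≃* stab (act U τ), ∀ z, (e' z : LU n) = U * (e z : LU n) * U⁻¹

end LUStab

open LUStab

/-!
A pure state is `proj ψ`, and a local unitary fixes it exactly when it multiplies `ψ` by a phase.
For `n ≠ 2` a symmetric projector has a permutation invariant amplitude vector `ψ`; for `n = 2`
the only other possibility is the singlet.

*Normal forms.* Let `ψ` be permutation invariant with infinite stabilizer. If some stabilizer
element has two factors `g_i ≠ g_j` in `PU(2)`, dividing it by its image under the transposition of
`i` and `j` shows that `h ⊗ h⁻¹` on these qubits fixes `ψ` for a nontrivial `h`. In an eigenbasis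
of `h` all mixed amplitudes vanish, so `ψ` becomes `a|0⋯0⟩ + b|1⋯1⟩` (`KetSym.exists_ghz`).
Otherwise every stabilizer element is `(g, …, g)` and permutes the finitely many zero lines in `ℂ²`
of the binary form `v ↦ ∑ I, ψ I ∏ k, v (I k)`. By the pigeonhole principle some nontrivial `h`
fixes all of them (`KetSym.exists_fixing_zeroLines`); in an eigenbasis of `h` the zeros lie on the
coordinate axes, the form is a monomial, and `ψ` becomes a Dicke state
(`KetSym.exists_single_weight`).

*Stabilizers.* In `PU(2)` the matrix `exp(-itZ/2)` is the class of `diag(1, exp(it))`, which gives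
an injective homomorphism `torus` from the circle. Each parametrisation is an injective homomorphism
built from `torus`, and for the `Z₂` extensions from `(X, …, X)`; it remains to see that its range
is the whole stabilizer. This is done by moving some tensor factors of a stabilizer element to the
other side of `g ψ = c ψ` and comparing amplitudes, which forces the factors to be diagonal or
antidiagonal.

*Separation of the kinds.* The stabilizers are pairwise non-isomorphic for fixed `n`: commutativity
and the number of solutions of `x ^ 3 = 1` tell them apart (`Profile.eq`).

*Counting.* Within the two families with more than one class, the one-qubit reduced states are
diagonal with largest eigenvalue `|a|²` and `(n - k) / n` respectively, and this eigenvalue is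
invariant (`probZero_eq_of_luEquiv`).
-/

namespace LUStab

open Matrix Complex
open scoped ComplexOrder

variable {n : ℕ}

/-! ### State vectors and their projectors -/


theorem tensor_mul_mulVec (g h : Fin n → U2) (ψ : Ket n) :
    tensor (g * h) *ᵥ ψ = tensor g *ᵥ (tensor h *ᵥ ψ) := by
  rw [tensor_mul, Matrix.mulVec_mulVec]

theorem tensor_inv_mulVec (g : Fin n → U2) (ψ : Ket n) :
    tensor g⁻¹ *ᵥ (tensor g *ᵥ ψ) = ψ := by
  rw [← tensor_mul_mulVec, inv_mul_cancel, tensor_one, Matrix.one_mulVec]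

theorem conjBy_proj (g : Fin n → U2) (ψ : Ket n) :
    conjBy g (proj ψ) = proj (tensor g *ᵥ ψ) := by
  rw [conjBy, proj, proj, Matrix.mul_vecMulVec, Matrix.vecMulVec_mul, Matrix.star_mulVec]

theorem proj_smul {c : ℂ} (hc : ‖c‖ = 1) (ψ : Ket n) : proj (c • ψ) = proj ψ := by
  ext I J
  simp only [proj, Matrix.vecMulVec_apply, Pi.smul_apply, Pi.star_apply, smul_eq_mul, star_mul']
  have : c * star c = 1 := by
    rw [Complex.star_def, Complex.mul_conj, Complex.normSq_eq_norm_sq, hc]; simp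
  linear_combination ψ I * star (ψ J) * this

theorem exists_smul_of_proj_eq {ψ φ : Ket n} (h : proj ψ = proj φ) :
    ∃ c : ℂ, ‖c‖ = 1 ∧ ψ = c • φ := by
  have hent : ∀ I J, ψ I * star (ψ J) = φ I * star (φ J) := fun I J =>
    congrFun (congrFun h I) J
  by_cases h0 : φ = 0
  · refine ⟨1, by simp, ?_⟩
    funext I
    have := hent I I
    simpa [h0] using this
  · obtain ⟨K, hK⟩ := Function.ne_iff.mp h0
    have hK : φ K ≠ 0 := hK
    have hn : ‖ψ K‖ = ‖φ K‖ := by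
      have := congrArg norm (hent K K)
      simp only [norm_mul, norm_star] at this
      nlinarith [norm_nonneg (ψ K), norm_nonneg (φ K)]
    have hψ : ψ K ≠ 0 := by
      rw [← norm_ne_zero_iff, hn, norm_ne_zero_iff]; exact hK
    refine ⟨star (φ K) / star (ψ K), ?_, ?_⟩
    · rw [norm_div, norm_star, norm_star, hn, div_self (norm_ne_zero_iff.mpr hK)]
    · funext I
      have := hent I K
      have h2 : star (ψ K) ≠ 0 := star_ne_zero.mpr hψ
      simp only [Pi.smul_apply, smul_eq_mul]
      field_simp
      linear_combination this

theorem toLU_mul (g h : Fin n → U2) : toLU (g * h) = toLU g * toLU h := rfl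

theorem toLU_inv (g : Fin n → U2) : toLU g⁻¹ = (toLU g)⁻¹ := rfl

theorem exists_toLU (U : LU n) : ∃ g : Fin n → U2, toLU g = U := ⟨_, toLU_out U⟩

theorem act_proj (g : Fin n → U2) (ψ : Ket n) : act (toLU g) (proj ψ) = proj (tensor g *ᵥ ψ) := by
  rw [act_toLU, conjBy_proj]

theorem act_proj_eq_iff (g : Fin n → U2) (ψ φ : Ket n) :
    act (toLU g) (proj ψ) = proj φ ↔ ∃ c : ℂ, ‖c‖ = 1 ∧ tensor g *ᵥ ψ = c • φ := by
  rw [act_proj]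
  refine ⟨exists_smul_of_proj_eq, ?_⟩
  rintro ⟨c, hc, h⟩
  rw [h, proj_smul hc]

theorem mem_stab {ρ : QMatrix n} {U : LU n} : U ∈ stab ρ ↔ act U ρ = ρ := Iff.rfl

theorem toLU_mem_stab (g : Fin n → U2) (ψ : Ket n) :
    toLU g ∈ stab (proj ψ) ↔ ∃ c : ℂ, ‖c‖ = 1 ∧ tensor g *ᵥ ψ = c • ψ :=
  act_proj_eq_iff g ψ ψ

/-! ### Local unitary equivalence -/

theorem LUEquiv.refl (ρ : QMatrix n) : LUEquiv ρ ρ := ⟨1, act_one ρ⟩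

theorem LUEquiv.symm {ρ σ : QMatrix n} : LUEquiv ρ σ → LUEquiv σ ρ := by
  rintro ⟨U, rfl⟩
  exact ⟨U⁻¹, by rw [← act_mul, inv_mul_cancel, act_one]⟩

theorem LUEquiv.trans {ρ σ τ : QMatrix n} : LUEquiv ρ σ → LUEquiv σ τ → LUEquiv ρ τ := by
  rintro ⟨U, rfl⟩ ⟨V, rfl⟩
  exact ⟨V * U, act_mul V U ρ⟩

theorem luEquiv_of_mulVec {ψ φ : Ket n} (g : Fin n → U2) {c : ℂ} (hc : ‖c‖ = 1)
    (h : tensor g *ᵥ ψ = c • φ) : LUEquiv (proj ψ) (proj φ) :=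
  ⟨toLU g, (act_proj_eq_iff g ψ φ).mpr ⟨c, hc, h⟩⟩

theorem luClass_eq_iff {ρ σ : QMatrix n} (hp : IsPure σ) (hs : IsSymmetric σ) :
    luClass ρ = luClass σ ↔ LUEquiv ρ σ := by
  constructor
  · intro h
    have : σ ∈ luClass σ := ⟨hp, hs, LUEquiv.refl σ⟩
    rw [← h] at this
    exact this.2.2
  · intro h
    ext τ
    exact ⟨fun ⟨a, b, c⟩ => ⟨a, b, h.symm.trans c⟩, fun ⟨a, b, c⟩ => ⟨a, b, h.trans c⟩⟩

/-! ### Elements of `U(2)` and `PU(2)` -/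

theorem U2.normSq_row (g : U2) (i : Fin 2) : ‖g.1 i 0‖ ^ 2 + ‖g.1 i 1‖ ^ 2 = 1 := by
  have h := congrFun (congrFun (Matrix.mem_unitaryGroup_iff.mp g.2) i) i
  rw [Matrix.mul_apply, Fin.sum_univ_two] at h
  simp only [Matrix.star_apply, Complex.star_def, Complex.mul_conj, Matrix.one_apply_eq,
    Complex.normSq_eq_norm_sq] at h
  exact_mod_cast h

theorem U2.normSq_col (g : U2) (i : Fin 2) : ‖g.1 0 i‖ ^ 2 + ‖g.1 1 i‖ ^ 2 = 1 := by
  have h := U2.normSq_row g⁻¹ i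
  simpa [Matrix.UnitaryGroup.inv_val, Matrix.star_apply] using h

theorem U2.norm_offdiag (g : U2) : ‖g.1 0 1‖ = ‖g.1 1 0‖ := by
  have h1 := U2.normSq_row g 0
  have h2 := U2.normSq_col g 0
  have : ‖g.1 0 1‖ ^ 2 = ‖g.1 1 0‖ ^ 2 := by linarith
  exact (pow_left_inj₀ (norm_nonneg _) (norm_nonneg _) two_ne_zero).mp this

theorem U2.norm_diag (g : U2) : ‖g.1 0 0‖ = ‖g.1 1 1‖ := by
  have h1 := U2.normSq_row g 0
  have h2 := U2.normSq_col g 1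
  have : ‖g.1 0 0‖ ^ 2 = ‖g.1 1 1‖ ^ 2 := by linarith
  exact (pow_left_inj₀ (norm_nonneg _) (norm_nonneg _) two_ne_zero).mp this

theorem U2.offdiag_eq_zero_iff (g : U2) : g.1 0 1 = 0 ↔ g.1 1 0 = 0 := by
  rw [← norm_eq_zero, U2.norm_offdiag, norm_eq_zero]

theorem U2.diag_eq_zero_iff (g : U2) : g.1 0 0 = 0 ↔ g.1 1 1 = 0 := by
  rw [← norm_eq_zero, U2.norm_diag, norm_eq_zero]

theorem U2.diag_ne_zero {g : U2} (h : g.1 1 0 = 0) : g.1 0 0 ≠ 0 := by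
  intro h0
  have := U2.normSq_col g 0
  simp [h, h0] at this

theorem U2.norm_diag_of_offdiag {g : U2} (h : g.1 1 0 = 0) (i : Fin 2) : ‖g.1 i i‖ = 1 := by
  have h1 := U2.normSq_col g 0
  have h0 : ‖g.1 0 0‖ = 1 := by
    rw [h] at h1
    simp only [norm_zero] at h1
    nlinarith [norm_nonneg (g.1 0 0)]
  fin_cases i
  · exact h0
  · exact U2.norm_diag g ▸ h0

theorem mem_phases_iff (g : U2) : g ∈ phases ↔ g.1 1 0 = 0 ∧ g.1 0 0 = g.1 1 1 := by
  constructor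
  · rintro ⟨c, hc⟩
    rw [hc]
    simp
  · rintro ⟨h1, h2⟩
    refine ⟨g.1 0 0, ?_⟩
    have h3 := (U2.offdiag_eq_zero_iff g).mpr h1
    ext i j
    fin_cases i <;> fin_cases j <;> simp [h1, h2, h3]

/-- The unitary matrix `diag(z, w)`. -/
def diagU (z w : Circle) : U2 :=
  ⟨!![(z : ℂ), 0; 0, (w : ℂ)], by
    rw [Matrix.mem_unitaryGroup_iff]
    have h : ∀ z : Circle, (z : ℂ) * (starRingEnd ℂ) z = 1 := fun z => by
      rw [Complex.mul_conj, Circle.normSq_coe]; simp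
    ext i j
    fin_cases i <;> fin_cases j <;> simp [Matrix.mul_apply, Matrix.star_apply, h]⟩

@[simp] theorem diagU_val (z w : Circle) : (diagU z w).1 = !![(z : ℂ), 0; 0, (w : ℂ)] := rfl

theorem diagU_mul (z w z' w' : Circle) : diagU z w * diagU z' w' = diagU (z * z') (w * w') := by
  apply Subtype.ext
  rw [Matrix.UnitaryGroup.mul_val]
  ext i j
  fin_cases i <;> fin_cases j <;> simp [Matrix.mul_apply]

/-- The torus `z ↦ [diag(1, z)]` of `PU(2)`. It is parametrised by the full circle, whereas
`exp(-itZ/2)` needs `t` up to `4π` to close up in `U(2)`. -/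
noncomputable def torus : Circle →* PU2 where
  toFun z := QuotientGroup.mk (diagU 1 z)
  map_one' := by
    rw [QuotientGroup.eq_one_iff, mem_phases_iff]
    simp
  map_mul' z w := by
    rw [← QuotientGroup.mk_mul, diagU_mul, one_mul]

theorem torus_apply (z : Circle) : torus z = QuotientGroup.mk (diagU 1 z) := rfl

theorem torus_injective : Function.Injective torus := by
  rw [injective_iff_map_eq_one]
  intro z hz
  rw [torus_apply, QuotientGroup.eq_one_iff, mem_phases_iff] at hz
  have := hz.2
  simp only [diagU_val, Matrix.of_apply, Matrix.cons_val', Matrix.cons_val_zero, Matrix.cons_val_one,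
    Matrix.cons_val_fin_one, Circle.coe_one] at this
  exact (Circle.ext this).symm

theorem exists_torus_of_offdiag {g : U2} (h : g.1 1 0 = 0) :
    ∃ z : Circle, torus z = QuotientGroup.mk g := by
  have h01 := (U2.offdiag_eq_zero_iff g).mpr h
  have hm : ∀ i, g.1 i i ∈ Submonoid.unitSphere ℂ := fun i => by
    exact mem_sphere_zero_iff_norm.mpr (U2.norm_diag_of_offdiag h i)
  let z0 : Circle := ⟨g.1 0 0, hm 0⟩
  let z1 : Circle := ⟨g.1 1 1, hm 1⟩
  have hg : g = diagU z0 z1 := by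
    apply Subtype.ext
    have hz0 : (z0 : ℂ) = g.1 0 0 := rfl
    have hz1 : (z1 : ℂ) = g.1 1 1 := rfl
    rw [diagU_val, hz0, hz1]
    ext i j
    fin_cases i <;> fin_cases j <;> simp [h, h01]
  refine ⟨z0⁻¹ * z1, ?_⟩
  have hd : diagU z0 z1 = diagU 1 (z0⁻¹ * z1) * diagU z0 z0 := by
    rw [diagU_mul]; simp
  rw [hg, hd, QuotientGroup.mk_mul, torus_apply]
  have : (QuotientGroup.mk (diagU z0 z0) : PU2) = 1 := by
    rw [QuotientGroup.eq_one_iff, mem_phases_iff]; simp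
  rw [this, mul_one]

theorem torus_exp (t : ℝ) : torus (Circle.exp t) = QuotientGroup.mk (rotZ t) := by
  rw [torus_apply, QuotientGroup.eq]
  have : (diagU 1 (Circle.exp t))⁻¹ * rotZ t ∈ phases := by
    rw [mem_phases_iff, Matrix.UnitaryGroup.mul_val, Matrix.UnitaryGroup.inv_val]
    simp only [rotZ, exp_pauliZ]
    simp only [diagU_val, Matrix.mul_apply, Fin.sum_univ_two, Matrix.star_apply]
    simp [Circle.coe_exp, ← Complex.exp_conj, ← Complex.exp_add]
    congr 1
    ring
  exact this

theorem flipX_val : (flipX).1 = !![0, 1; 1, 0] := rfl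

theorem flipX_mul_self : flipX * flipX = 1 := by
  apply Subtype.ext
  rw [Matrix.UnitaryGroup.mul_val, flipX_val]
  ext i j
  fin_cases i <;> fin_cases j <;> simp [Matrix.mul_apply]

theorem flipX_torus (z : Circle) :
    (QuotientGroup.mk flipX : PU2) * torus z = (torus z)⁻¹ * QuotientGroup.mk flipX := by
  rw [← map_inv, torus_apply, torus_apply, ← QuotientGroup.mk_mul, ← QuotientGroup.mk_mul]
  have h : flipX * diagU 1 z = (diagU 1 z⁻¹ * flipX) * diagU z z := by
    apply Subtype.ext
    simp only [Matrix.UnitaryGroup.mul_val, flipX_val, diagU_val]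
    ext i j
    fin_cases i <;> fin_cases j <;> simp [Matrix.mul_apply]
  rw [h, QuotientGroup.mk_mul]
  have : (QuotientGroup.mk (diagU z z) : PU2) = 1 := by
    rw [QuotientGroup.eq_one_iff, mem_phases_iff]; simp
  rw [this, mul_one]

/-! ### Action of special local unitaries in the computational basis -/

theorem tensor_mulVec_apply (g : Fin n → U2) (ψ : Ket n) (I : Fin n → Fin 2) :
    (tensor g *ᵥ ψ) I = ∑ J, (∏ k, (g k).1 (I k) (J k)) * ψ J := rfl

/-- A unitary acting on the single qubit `j`. -/
theorem tensor_mulSingle_mulVec (j : Fin n) (h : U2) (ψ : Ket n) (I : Fin n → Fin 2) :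
    (tensor (Pi.mulSingle j h) *ᵥ ψ) I = ∑ x, h.1 (I j) x * ψ (Function.update I j x) := by
  rw [tensor_mulVec_apply]
  symm
  refine Finset.sum_of_injOn (fun x => Function.update I j x) ?_ (by simp) ?_ ?_
  · intro x _ y _ hxy
    exact Function.update_injective I j hxy
  · intro J _ hJ
    have : ∃ k, k ≠ j ∧ I k ≠ J k := by
      by_contra! hc
      apply hJ
      refine ⟨J j, by simp, ?_⟩
      funext k
      by_cases hk : k = j
      · subst hk; simp
      · simp [hk, hc k hk]
    obtain ⟨k, hk, hIJ⟩ := this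
    rw [Finset.prod_eq_zero (Finset.mem_univ k), zero_mul]
    simp [hk, hIJ]
  · intro x _
    congr 1
    rw [Finset.prod_eq_single j]
    · simp
    · intro k _ hk
      simp [hk]
    · simp

/-- Diagonal local unitaries multiply each amplitude by a scalar. -/
theorem tensor_diag_mulVec {g : Fin n → U2} (hg : ∀ k, (g k).1 1 0 = 0) (ψ : Ket n)
    (I : Fin n → Fin 2) : (tensor g *ᵥ ψ) I = (∏ k, (g k).1 (I k) (I k)) * ψ I := by
  rw [tensor_mulVec_apply, Finset.sum_eq_single I]
  · intro J _ hJ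
    obtain ⟨k, hk⟩ := Function.ne_iff.mp hJ
    rw [Finset.prod_eq_zero (Finset.mem_univ k), zero_mul]
    have h01 := (U2.offdiag_eq_zero_iff (g k)).mpr (hg k)
    generalize I k = x at *
    generalize J k = y at *
    fin_cases x <;> fin_cases y <;> simp_all
  · simp

theorem tensor_single_mulVec (g : Fin n → U2) (K I : Fin n → Fin 2) (a : ℂ) :
    (tensor g *ᵥ Pi.single K a) I = a * ∏ k, (g k).1 (I k) (K k) := by
  rw [Matrix.mulVec_single]
  simp [tensor, mul_comm]

theorem tensor_ghz_mulVec (g : Fin n → U2) (a b : ℂ) (I : Fin n → Fin 2) :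
    (tensor g *ᵥ ghzKet n a b) I =
      a * ∏ k, (g k).1 (I k) 0 + b * ∏ k, (g k).1 (I k) 1 := by
  rw [ghzKet, Matrix.mulVec_add, Pi.add_apply, tensor_single_mulVec, tensor_single_mulVec]
  rfl

theorem tensor_flip_mulVec (ψ : Ket n) (I : Fin n → Fin 2) :
    (tensor (fun _ => flipX) *ᵥ ψ) I = ψ (fun k => 1 - I k) := by
  rw [tensor_mulVec_apply, Finset.sum_eq_single (fun k => 1 - I k)]
  · rw [Finset.prod_eq_one, one_mul]
    intro k _
    rw [flipX_val]
    beta_reduce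
    generalize I k = x
    fin_cases x <;> simp
  · intro J _ hJ
    obtain ⟨k, hk⟩ := Function.ne_iff.mp hJ
    rw [Finset.prod_eq_zero (Finset.mem_univ k), zero_mul]
    simp only [flipX_val]
    generalize I k = x at *
    generalize J k = y at *
    fin_cases x <;> fin_cases y <;> simp_all
  · simp

/-! ### Diagonalisation in `U(2)` -/


theorem exists_U2 {a b : ℂ} (h : ‖a‖ ^ 2 + ‖b‖ ^ 2 = 1) :
    ∃ V : U2, V.1 = !![a, -star b; b, star a] := by
  have h' : a * star a + b * star b = 1 := by
    rw [Complex.star_def, Complex.mul_conj, Complex.mul_conj,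
      Complex.normSq_eq_norm_sq, Complex.normSq_eq_norm_sq]
    exact_mod_cast h
  refine ⟨⟨!![a, -star b; b, star a], ?_⟩, rfl⟩
  rw [Matrix.mem_unitaryGroup_iff]
  ext i j
  fin_cases i <;> fin_cases j <;>
    simp [Matrix.mul_apply, Matrix.star_apply] <;>
    simp only [Complex.star_def] at h' <;>
    first
      | linear_combination h'
      | ring

theorem U2.exists_diagonalizing (g : U2) : ∃ V : U2, (V⁻¹ * g * V).1 1 0 = 0 := by
  obtain ⟨μ, hμ⟩ := Module.End.exists_eigenvalue (Matrix.toLin' g.1)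
  obtain ⟨v, hv⟩ := hμ.exists_hasEigenvector
  have hgv : g.1 *ᵥ v = μ • v := by
    have := hv.apply_eq_smul
    rwa [Matrix.toLin'_apply] at this
  have hv0 : v ≠ 0 := hv.2
  have hs : 0 < ‖v 0‖ ^ 2 + ‖v 1‖ ^ 2 := by
    by_contra hc
    apply hv0
    have h0 : ‖v 0‖ = 0 := by nlinarith [sq_nonneg ‖v 0‖, sq_nonneg ‖v 1‖]
    have h1 : ‖v 1‖ = 0 := by nlinarith [sq_nonneg ‖v 0‖, sq_nonneg ‖v 1‖]
    funext i
    fin_cases i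
    · exact norm_eq_zero.mp h0
    · exact norm_eq_zero.mp h1
  set r : ℝ := √(‖v 0‖ ^ 2 + ‖v 1‖ ^ 2) with hr
  have hr0 : 0 < r := Real.sqrt_pos.mpr hs
  have hr2 : r ^ 2 = ‖v 0‖ ^ 2 + ‖v 1‖ ^ 2 := Real.sq_sqrt hs.le
  obtain ⟨V, hV⟩ := exists_U2 (a := v 0 / r) (b := v 1 / r) (by
    rw [norm_div, norm_div, Complex.norm_real, Real.norm_of_nonneg hr0.le, div_pow, div_pow,
      ← add_div, hr2, div_self hs.ne'])
  refine ⟨V, ?_⟩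
  have e0 := congrFun hgv 0
  have e1 := congrFun hgv 1
  simp only [Matrix.mulVec, dotProduct, Fin.sum_univ_two, Pi.smul_apply, smul_eq_mul] at e0 e1
  simp only [Matrix.UnitaryGroup.mul_val, Matrix.UnitaryGroup.inv_val, hV]
  simp [Matrix.mul_apply, Fin.sum_univ_two, Matrix.star_apply]
  linear_combination ((v 0 : ℂ) / r / r) * e1 - (v 1 / r / r) * e0

theorem U2.exists_diagonalizing_of_not_phase {g : U2} (hg : g ∉ phases) :
    ∃ V : U2, (V⁻¹ * g * V).1 1 0 = 0 ∧ (V⁻¹ * g * V).1 0 0 ≠ (V⁻¹ * g * V).1 1 1 := by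
  obtain ⟨V, hV⟩ := U2.exists_diagonalizing g
  refine ⟨V, hV, fun h => hg ?_⟩
  have h1 : V⁻¹ * g * V ∈ phases := (mem_phases_iff _).mpr ⟨hV, h⟩
  have h2 := phases_normal.conj_mem _ h1 V
  have h3 : V * (V⁻¹ * g * V) * V⁻¹ = g := by group
  rwa [h3] at h2

/-! ### Pure states -/

theorem trace_proj (ψ : Ket n) : (proj ψ).trace = ((∑ I, ‖ψ I‖ ^ 2 : ℝ) : ℂ) := by
  simp only [Matrix.trace, proj, Matrix.diag, Matrix.vecMulVec_apply, Pi.star_apply,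
    Complex.star_def, Complex.mul_conj, Complex.normSq_eq_norm_sq]
  push_cast
  rfl

theorem trace_proj_eq_one_iff (ψ : Ket n) : (proj ψ).trace = 1 ↔ ∑ I, ‖ψ I‖ ^ 2 = 1 := by
  rw [trace_proj]
  exact_mod_cast Iff.rfl

theorem isPure_proj {ψ : Ket n} (h : (proj ψ).trace = 1) : IsPure (proj ψ) := by
  refine ⟨⟨Matrix.posSemidef_vecMulVec_self_star ψ, h⟩, le_antisymm ?_ ?_⟩
  · exact Matrix.rank_vecMulVec_le _ _
  · rw [Nat.one_le_iff_ne_zero]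
    intro h0
    rw [Matrix.rank, Submodule.finrank_eq_zero, LinearMap.range_eq_bot] at h0
    replace h0 : proj ψ = 0 := by
      ext I J
      have := congrFun (LinearMap.congr_fun h0 (Pi.single J 1)) I
      simpa using this
    rw [h0] at h
    simp at h

theorem exists_ket_of_isPure {ρ : QMatrix n} (h : IsPure ρ) : ∃ ψ : Ket n, ρ = proj ψ := by
  obtain ⟨⟨hpos, htr⟩, hrank⟩ := h
  have hne : ρ ≠ 0 := by rintro rfl; simp at htr
  -- A matrix of rank one is an outer product; hermiticity makes the factors conjugate.
  obtain ⟨u, v, huv⟩ : ∃ u v : Ket n, ρ = Matrix.vecMulVec u v := by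
    rw [Matrix.rank] at hrank
    obtain ⟨u, -, hu⟩ := finrank_eq_one_iff'.mp hrank
    choose c hc using fun J => hu ⟨ρ.col J, ⟨Pi.single J 1, by simp⟩⟩
    refine ⟨u.1, c, ?_⟩
    ext I J
    have := congrFun (congrArg Subtype.val (hc J)) I
    simp only [Matrix.col_apply, SetLike.val_smul, Pi.smul_apply, smul_eq_mul] at this
    rw [Matrix.vecMulVec_apply, ← this, mul_comm]
  have htr' : ∑ J, u J * v J = 1 := by
    rw [← htr, huv]; simp [Matrix.trace, Matrix.vecMulVec_apply]
  have hherm : ∀ I J, u I * v J = star (u J) * star (v I) := by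
    intro I J
    have := congrFun (congrFun hpos.1 I) J
    rw [Matrix.conjTranspose_apply, huv, Matrix.vecMulVec_apply, Matrix.vecMulVec_apply,
      star_mul'] at this
    exact this.symm
  set s : ℝ := ∑ J, ‖u J‖ ^ 2 with hs
  have hsC : ∑ J, u J * star (u J) = (s : ℂ) := by
    simp only [Complex.star_def, Complex.mul_conj, Complex.normSq_eq_norm_sq, hs]
    push_cast
    rfl
  have hu : ∀ I, u I = s * star (v I) := by
    intro I
    calc u I = u I * ∑ J, u J * v J := by rw [htr', mul_one]
      _ = ∑ J, u J * (u I * v J) := by rw [Finset.mul_sum]; congr 1; funext J; ring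
      _ = ∑ J, (u J * star (u J)) * star (v I) := by
        congr 1; funext J; rw [hherm]; ring
      _ = s * star (v I) := by rw [← Finset.sum_mul, hsC]
  have hs0 : 0 ≤ s := Finset.sum_nonneg fun _ _ => by positivity
  have hsq : ((√s : ℝ) : ℂ) * (√s : ℝ) = s := by
    rw [← Complex.ofReal_mul, Real.mul_self_sqrt hs0]
  refine ⟨((√s : ℝ) : ℂ) • star v, ?_⟩
  ext I J
  rw [huv, Matrix.vecMulVec_apply, hu, proj, Matrix.vecMulVec_apply]
  simp only [Pi.smul_apply, Pi.star_apply, smul_eq_mul, star_mul', Complex.star_def,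
    Complex.conj_ofReal, Complex.conj_conj]
  linear_combination (-(starRingEnd ℂ) (v I) * v J) * hsq

theorem trace_proj_mulVec (g : Fin n → U2) (ψ : Ket n) :
    (proj (tensor g *ᵥ ψ)).trace = (proj ψ).trace := by
  have h : (tensor g)ᴴ = tensor g⁻¹ := by
    ext I J
    simp [tensor, Matrix.UnitaryGroup.inv_val, Matrix.star_apply]
  rw [← conjBy_proj, conjBy, Matrix.trace_mul_cycle, h, ← tensor_mul, inv_mul_cancel, tensor_one,
    Matrix.one_mul]

theorem norm_eq_one_of_trace {ψ φ : Ket n} {c : ℂ} (h : ψ = c • φ) (h1 : (proj ψ).trace = 1)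
    (h2 : (proj φ).trace = 1) : ‖c‖ = 1 := by
  rw [trace_proj_eq_one_iff] at h1 h2
  rw [h] at h1
  simp only [Pi.smul_apply, smul_eq_mul, norm_mul, mul_pow] at h1
  rw [← Finset.mul_sum, h2, mul_one] at h1
  nlinarith [norm_nonneg c]

/-! ### Symmetric state vectors and Hamming weight -/

/-- Invariance of a state vector, and not only of its projector, under permutations of the
qubits. -/
def KetSym (ψ : Ket n) : Prop := ∀ (π : Equiv.Perm (Fin n)) (I : Fin n → Fin 2), ψ (I ∘ π) = ψ I

/-- The number of ones in a bit string. -/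
def wt (I : Fin n → Fin 2) : ℕ := ∑ j, (I j : ℕ)

theorem wt_comp (I : Fin n → Fin 2) (π : Equiv.Perm (Fin n)) : wt (I ∘ π) = wt I :=
  Equiv.sum_comp π fun j => (I j : ℕ)

theorem wt_eq_card (I : Fin n → Fin 2) : wt I = (Finset.univ.filter fun j => I j = 1).card := by
  rw [wt, Finset.card_filter]
  congr 1
  funext j
  generalize I j = x
  fin_cases x <;> simp

theorem wt_le (I : Fin n → Fin 2) : wt I ≤ n := by
  rw [wt_eq_card]
  exact (Finset.card_le_univ _).trans (by simp)

theorem exists_perm_of_wt_eq {I J : Fin n → Fin 2} (h : wt I = wt J) :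
    ∃ π : Equiv.Perm (Fin n), I = J ∘ π := by
  rw [wt_eq_card, wt_eq_card, ← Fintype.card_subtype, ← Fintype.card_subtype] at h
  let e := Fintype.equivOfCardEq h
  refine ⟨e.extendSubtype, ?_⟩
  funext j
  by_cases hj : I j = 1
  · rw [Function.comp_apply, e.extendSubtype_mem j hj, hj]
  · have := e.extendSubtype_not_mem j hj
    rw [Function.comp_apply]
    generalize I j = x at *
    generalize J (e.extendSubtype j) = y at *
    fin_cases x <;> fin_cases y <;> simp_all

theorem KetSym.eq_of_wt {ψ : Ket n} (hψ : KetSym ψ) {I J : Fin n → Fin 2} (h : wt I = wt J) :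
    ψ I = ψ J := by
  obtain ⟨π, rfl⟩ := exists_perm_of_wt_eq h
  exact hψ π J

theorem card_wt (n k : ℕ) :
    (Finset.univ.filter fun I : Fin n → Fin 2 => wt I = k).card = n.choose k := by
  have hc := Finset.card_powersetCard k (Finset.univ : Finset (Fin n))
  rw [Finset.card_univ, Fintype.card_fin] at hc
  rw [← hc]
  refine Finset.card_bij (fun I _ => Finset.univ.filter fun j => I j = 1) ?_ ?_ ?_
  · intro I hI
    rw [Finset.mem_powersetCard, ← wt_eq_card]
    exact ⟨Finset.subset_univ _, (Finset.mem_filter.mp hI).2⟩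
  · intro I _ J _ h
    funext j
    have := congrArg (fun s => j ∈ s) h
    simp only [Finset.mem_filter, Finset.mem_univ, true_and, eq_iff_iff] at this
    generalize I j = x at *
    generalize J j = y at *
    fin_cases x <;> fin_cases y <;> simp_all
  · intro s hs
    refine ⟨fun j => if j ∈ s then 1 else 0, ?_, ?_⟩
    · rw [Finset.mem_filter, wt_eq_card]
      simpa using (Finset.mem_powersetCard.mp hs).2
    · ext j
      simp

theorem exists_wt_eq {k : ℕ} (hk : k ≤ n) : ∃ I : Fin n → Fin 2, wt I = k := by
  have h := Nat.choose_pos hk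
  rw [← card_wt, Finset.card_pos] at h
  exact ⟨_, (Finset.mem_filter.mp h.choose_spec).2⟩

theorem dickeKet_apply (n k : ℕ) (I : Fin n → Fin 2) :
    dickeKet n k I = if wt I = k then ((1 / √(n.choose k : ℝ) : ℝ) : ℂ) else 0 := rfl

theorem ketSym_dicke (n k : ℕ) : KetSym (dickeKet n k) := by
  intro π I
  rw [dickeKet_apply, dickeKet_apply, wt_comp]

theorem dicke_amp_ne_zero {n k : ℕ} (hk : k ≤ n) : ((1 / √(n.choose k : ℝ) : ℝ) : ℂ) ≠ 0 := by
  have : 0 < (n.choose k : ℝ) := by exact_mod_cast Nat.choose_pos hk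
  exact Complex.ofReal_ne_zero.mpr (by positivity)

theorem trace_proj_dicke {n k : ℕ} (hk : k ≤ n) : (proj (dickeKet n k)).trace = 1 := by
  rw [trace_proj_eq_one_iff]
  have hpos : 0 < (n.choose k : ℝ) := by exact_mod_cast Nat.choose_pos hk
  have : ∀ I : Fin n → Fin 2, ‖dickeKet n k I‖ ^ 2 = if wt I = k then 1 / (n.choose k : ℝ) else 0 := by
    intro I
    rw [dickeKet_apply]
    split_ifs
    · rw [Complex.norm_real, Real.norm_of_nonneg (by positivity), div_pow, Real.sq_sqrt hpos.le,
        one_pow]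
    · simp
  simp only [this]
  rw [← Finset.sum_filter, Finset.sum_const, card_wt, nsmul_eq_mul]
  field_simp

theorem isSymmetric_proj {ψ : Ket n} (h : KetSym ψ) : IsSymmetric (proj ψ) := by
  intro π
  ext I J
  simp [proj, Matrix.vecMulVec_apply, h π I, h π J]

theorem ketSym_ghz (n : ℕ) (a b : ℂ) : KetSym (ghzKet n a b) := by
  intro π I
  have h0 : I ∘ π = 0 ↔ I = 0 :=
    ⟨fun h => funext fun j => by simpa using congrFun h (π.symm j), by rintro rfl; rfl⟩
  have h1 : I ∘ π = 1 ↔ I = 1 :=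
    ⟨fun h => funext fun j => by simpa using congrFun h (π.symm j), by rintro rfl; rfl⟩
  simp [ghzKet, Pi.single_apply, h0, h1]

theorem productKet_eq (n : ℕ) : productKet n = ghzKet n 1 0 := by
  simp [productKet, ghzKet]

theorem zero_ne_one_bits (hn : 1 ≤ n) : (0 : Fin n → Fin 2) ≠ 1 := fun h => by
  have := congrFun h ⟨0, hn⟩
  simp at this

theorem trace_proj_ghz (hn : 1 ≤ n) {a b : ℂ} :
    (proj (ghzKet n a b)).trace = 1 ↔ ‖a‖ ^ 2 + ‖b‖ ^ 2 = 1 := by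
  rw [trace_proj_eq_one_iff, ← Finset.sum_subset (Finset.subset_univ {0, 1}),
    Finset.sum_pair (zero_ne_one_bits hn)]
  · simp [ghzKet, zero_ne_one_bits hn, (zero_ne_one_bits hn).symm]
  · intro I _ hI
    simp only [Finset.mem_insert, Finset.mem_singleton, not_or] at hI
    simp [ghzKet, hI]

/-- For three or more qubits the sign with which transpositions act on an amplitude vector must
be `+1`, since every bit string has two equal bits; only two qubits admit an antisymmetric
state. -/
theorem ketSym_of_isSymmetric {ψ : Ket n} (hn : n ≠ 2) (h : IsSymmetric (proj ψ)) :
    KetSym ψ := by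
  by_cases hψ : ψ = 0
  · subst hψ; intro π I; rfl
  obtain ⟨K, hK⟩ := Function.ne_iff.mp hψ
  have hK : ψ K ≠ 0 := hK
  have hex : ∀ π : Equiv.Perm (Fin n), ∃ c : ℂ, ‖c‖ = 1 ∧ (fun I => ψ (I ∘ π)) = c • ψ := by
    intro π
    apply exists_smul_of_proj_eq
    rw [← h π]
    conv_rhs => rw [h π]
    rw [← h π]
    rfl
  choose χ hχ1 hχ using hex
  have hχ' : ∀ (π : Equiv.Perm (Fin n)) I, ψ (I ∘ π) = χ π * ψ I := fun π I => congrFun (hχ π) I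
  have hmul : ∀ π σ, χ (π * σ) = χ π * χ σ := by
    intro π σ
    have e : ψ (K ∘ (π * σ : Equiv.Perm (Fin n))) = ψ ((K ∘ π) ∘ σ) := rfl
    rw [hχ', hχ', hχ'] at e
    exact mul_right_cancel₀ hK (by linear_combination e)
  have hone : χ 1 = 1 := by
    have e := hχ' 1 K
    have : ψ (K ∘ (1 : Equiv.Perm (Fin n))) = ψ K := rfl
    rw [this] at e
    exact mul_right_cancel₀ hK (by linear_combination -e)
  have hswap : ∀ x y : Fin n, x ≠ y → χ (Equiv.swap x y) = 1 := by
    intro x y hxy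
    have hn2 : 2 < n := by
      have h1 : 1 < Fintype.card (Fin n) := Fintype.one_lt_card_iff.mpr ⟨x, y, hxy⟩
      rw [Fintype.card_fin] at h1
      omega
    obtain ⟨w, z, hwz, he⟩ := Fintype.exists_ne_map_eq_of_card_lt K (by simpa using hn2)
    have h1 : χ (Equiv.swap w z) = 1 := by
      have e := hχ' (Equiv.swap w z) K
      have : K ∘ Equiv.swap w z = K := by
        funext j
        rw [Function.comp_apply]
        by_cases hj : j = w
        · rw [hj, Equiv.swap_apply_left, he]
        · by_cases hj' : j = z
          · rw [hj', Equiv.swap_apply_right, he]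
          · rw [Equiv.swap_apply_of_ne_of_ne hj hj']
      rw [this] at e
      exact mul_right_cancel₀ hK (by linear_combination -e)
    obtain ⟨c, hc⟩ := isConj_iff.mp (Equiv.Perm.isConj_swap hxy hwz)
    rw [← hc, hmul, hmul] at h1
    have h2 : χ c * χ c⁻¹ = 1 := by rw [← hmul, mul_inv_cancel, hone]
    linear_combination h1 - χ (Equiv.swap x y) * h2
  have hall : ∀ π, χ π = 1 := by
    intro π
    induction π using Equiv.Perm.swap_induction_on with
    | one => exact hone
    | swap_mul f x y hxy ih => rw [hmul, hswap x y hxy, ih, one_mul]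
  intro π I
  rw [hχ', hall, one_mul]

/-! ### The binary form of a state vector -/

section

open Polynomial

/-- The form `v ↦ ∑ I, ψ I ∏ k, v (I k)` of degree `n` on `ℂ²`, whose zero lines are the
Majorana points of a symmetric `ψ`. -/
def form (ψ : Ket n) (v : Fin 2 → ℂ) : ℂ := ∑ I, ψ I * ∏ k, v (I k)

/-- The dehomogenised form `x ↦ form ψ (1, x)`. -/
noncomputable def formPoly (ψ : Ket n) : ℂ[X] := ∑ I, C (ψ I) * X ^ wt I

theorem form_mulVec (g : U2) (ψ : Ket n) (v : Fin 2 → ℂ) :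
    form (tensor (fun _ => g) *ᵥ ψ) v = form ψ (v ᵥ* g.1) := by
  simp only [form, tensor_mulVec_apply, Finset.sum_mul]
  rw [Finset.sum_comm]
  congr 1
  funext J
  simp only [Matrix.vecMul, dotProduct]
  rw [Finset.prod_univ_sum, Fintype.piFinset_univ, Finset.mul_sum]
  congr 1
  funext I
  rw [Finset.prod_mul_distrib]
  ring

theorem form_smul (c : ℂ) (ψ : Ket n) (v : Fin 2 → ℂ) : form (c • ψ) v = c * form ψ v := by
  simp [form, Finset.mul_sum, mul_assoc]

theorem prod_bits {v : Fin 2 → ℂ} (hv : v 0 ≠ 0) (I : Fin n → Fin 2) :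
    ∏ k, v (I k) = v 0 ^ n * (v 1 / v 0) ^ wt I := by
  have h : ∀ k, v (I k) = v 0 * (v 1 / v 0) ^ (I k : ℕ) := by
    intro k
    generalize I k = x
    fin_cases x <;> simp
    field_simp
  rw [Finset.prod_congr rfl fun k _ => h k, Finset.prod_mul_distrib, Finset.prod_pow_eq_pow_sum,
    Finset.prod_const, Finset.card_univ, Fintype.card_fin]
  rfl

theorem form_eq_eval (ψ : Ket n) {v : Fin 2 → ℂ} (hv : v 0 ≠ 0) :
    form ψ v = v 0 ^ n * (formPoly ψ).eval (v 1 / v 0) := by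
  rw [form, formPoly, Polynomial.eval_finsetSum, Finset.mul_sum]
  congr 1
  funext I
  simp only [eval_mul, eval_C, eval_pow, eval_X]
  rw [prod_bits hv]
  ring

theorem KetSym.coeff_formPoly {ψ : Ket n} (hψ : KetSym ψ) (I : Fin n → Fin 2) :
    (formPoly ψ).coeff (wt I) = n.choose (wt I) * ψ I := by
  simp only [formPoly, Polynomial.finsetSum_coeff, coeff_C_mul, coeff_X_pow, mul_ite, mul_one,
    mul_zero]
  rw [← Finset.sum_filter, Finset.sum_congr rfl (g := fun _ => ψ I), Finset.sum_const,
    nsmul_eq_mul, ← card_wt n (wt I)]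
  · simp only [eq_comm]
  · intro J hJ
    exact hψ.eq_of_wt (Finset.mem_filter.mp hJ).2.symm

theorem KetSym.formPoly_ne_zero {ψ : Ket n} (hψ : KetSym ψ) (h0 : ψ ≠ 0) : formPoly ψ ≠ 0 := by
  obtain ⟨K, hK⟩ := Function.ne_iff.mp h0
  intro h
  have := hψ.coeff_formPoly K
  rw [h, coeff_zero, eq_comm, mul_eq_zero] at this
  rcases this with h | h
  · exact (Nat.choose_pos (wt_le K)).ne' (by exact_mod_cast h)
  · exact hK h

/-- The zero lines of the form of `ψ`. The zero vector, a zero of the form when `n ≠ 0`, contributes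
the harmless element `⊥`. -/
def zeroLines (ψ : Ket n) : Set (Submodule ℂ (Fin 2 → ℂ)) :=
  {ℓ | ∃ v, form ψ v = 0 ∧ ℓ = ℂ ∙ v}

theorem KetSym.finite_zeroLines {ψ : Ket n} (hψ : KetSym ψ) (h0 : ψ ≠ 0) :
    (zeroLines ψ).Finite := by
  refine Set.Finite.subset (s := {⊥, ℂ ∙ ![0, 1]} ∪
    (fun r : ℂ => (ℂ ∙ ![1, r] : Submodule ℂ (Fin 2 → ℂ))) '' (formPoly ψ).roots.toFinset) ?_ ?_
  · exact (Set.toFinite _).union ((Finset.finite_toSet _).image _)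
  · rintro ℓ ⟨v, hv, rfl⟩
    by_cases hv0 : v 0 = 0
    · left
      by_cases hv1 : v 1 = 0
      · left
        rw [Submodule.span_singleton_eq_bot]
        funext i
        fin_cases i <;> simp [hv0, hv1]
      · right
        rw [Set.mem_singleton_iff,
          show v = (Units.mk0 _ hv1) • ![0, 1] by
            funext i; fin_cases i <;> simp [hv0, Units.smul_def]]
        exact Submodule.span_singleton_group_smul_eq _ _ _
    · right
      refine ⟨v 1 / v 0, ?_, ?_⟩
      · have := form_eq_eval ψ hv0
        rw [hv, eq_comm, mul_eq_zero] at this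
        have hr := this.resolve_left (pow_ne_zero _ hv0)
        simpa [Polynomial.mem_roots (hψ.formPoly_ne_zero h0)] using hr
      · conv_rhs => rw [show v = (Units.mk0 _ hv0) • ![1, v 1 / v 0] by
            funext i; fin_cases i <;> simp [Units.smul_def]; field_simp]
        exact (Submodule.span_singleton_group_smul_eq _ _ _).symm

/-- The elements of the stabilizer permute the finitely many zero lines, so two different
elements of an infinite stabilizer act alike and their quotient fixes every zero line. -/
theorem KetSym.exists_fixing_zeroLines {ψ : Ket n} (hψ : KetSym ψ) (h0 : ψ ≠ 0)
    (hinf : Infinite (stab (proj ψ)))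
    (hconst : ∀ g : Fin n → U2, toLU g ∈ stab (proj ψ) → ∃ h : U2, toLU g = toLU fun _ => h) :
    ∃ h : U2, h ∉ phases ∧ ∀ v, form ψ v = 0 → ∃ c : ℂ, v ᵥ* h.1 = c • v := by
  have hex : ∀ U : stab (proj ψ), ∃ h : U2, U.1 = toLU fun _ => h := by
    rintro ⟨U, hU⟩
    obtain ⟨g, rfl⟩ := exists_toLU U
    exact hconst g hU
  choose h hh using hex
  have hmap : ∀ U : stab (proj ψ), ∀ v, form ψ v = 0 → form ψ (v ᵥ* (h U).1) = 0 := by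
    intro U v hv
    have hU := U.2
    rw [hh U, toLU_mem_stab] at hU
    obtain ⟨c, -, hc⟩ := hU
    rw [← form_mulVec, hc, form_smul, hv, mul_zero]
  have : Finite (zeroLines ψ) := hψ.finite_zeroLines h0
  let act' : stab (proj ψ) → (zeroLines ψ → zeroLines ψ) := fun U ℓ =>
    ⟨ℓ.1.map (Matrix.vecMulLinear (h U).1), by
      obtain ⟨v, hv, hl⟩ := ℓ.2
      refine ⟨v ᵥ* (h U).1, hmap U v hv, ?_⟩
      rw [hl, LinearMap.map_span, Set.image_singleton, Matrix.vecMulLinear_apply]⟩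
  obtain ⟨U, W, hne, heq⟩ := Finite.exists_ne_map_eq_of_infinite act'
  refine ⟨h U * (h W)⁻¹, ?_, ?_⟩
  · intro hp
    apply hne
    apply Subtype.ext
    rw [hh U, hh W]
    funext k
    have h1 := (QuotientGroup.eq_one_iff _).mpr hp
    rw [QuotientGroup.mk_mul, QuotientGroup.mk_inv, mul_inv_eq_one] at h1
    exact h1
  · intro v hv
    have h1 := congrArg Subtype.val (congrFun heq ⟨_, v, hv, rfl⟩)
    simp only [act', LinearMap.map_span, Set.image_singleton, Matrix.vecMulLinear_apply] at h1
    have h2 : v ᵥ* (h U).1 ∈ (ℂ ∙ (v ᵥ* (h W).1) : Submodule ℂ (Fin 2 → ℂ)) :=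
      h1 ▸ Submodule.mem_span_singleton_self _
    obtain ⟨c, hc⟩ := Submodule.mem_span_singleton.mp h2
    refine ⟨c, ?_⟩
    rw [Matrix.UnitaryGroup.mul_val, ← Matrix.vecMul_vecMul, ← hc, Matrix.smul_vecMul,
      Matrix.vecMul_vecMul, ← Matrix.UnitaryGroup.mul_val, mul_inv_cancel,
      Matrix.UnitaryGroup.one_val, Matrix.vecMul_one]

theorem KetSym.mulVec_comp {ψ : Ket n} (hψ : KetSym ψ) (g : Fin n → U2)
    (π : Equiv.Perm (Fin n)) (I : Fin n → Fin 2) :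
    (tensor (g ∘ π) *ᵥ ψ) (I ∘ π) = (tensor g *ᵥ ψ) I := by
  rw [tensor_mulVec_apply, tensor_mulVec_apply,
    ← Equiv.sum_comp (Equiv.arrowCongr π⁻¹ (Equiv.refl (Fin 2)))]
  congr 1
  funext J
  have : (Equiv.arrowCongr π⁻¹ (Equiv.refl (Fin 2))) J = J ∘ π := rfl
  rw [this, hψ π J]
  congr 1
  exact Equiv.prod_comp π fun k => (g k).1 (I k) (J k)

theorem KetSym.tensor_const {ψ : Ket n} (hψ : KetSym ψ) (g : U2) :
    KetSym (tensor (fun _ => g) *ᵥ ψ) := fun π I => hψ.mulVec_comp (fun _ => g) π I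

theorem tensor_mulVec_ne_zero (g : Fin n → U2) {ψ : Ket n} (h : ψ ≠ 0) : tensor g *ᵥ ψ ≠ 0 := by
  intro h0
  apply h
  rw [← tensor_inv_mulVec g ψ, h0, Matrix.mulVec_zero]

/-- In an eigenbasis of an element fixing all zero lines, the only zeros of the form are the
coordinate axes, so the form is a monomial. -/
theorem KetSym.exists_single_weight {ψ : Ket n} (hψ : KetSym ψ) (h0 : ψ ≠ 0) {h : U2}
    (hh : h ∉ phases) (hfix : ∀ v, form ψ v = 0 → ∃ c : ℂ, v ᵥ* h.1 = c • v) :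
    ∃ (V : U2) (m : ℕ), ∀ I, wt I ≠ m → (tensor (fun _ => V) *ᵥ ψ) I = 0 := by
  obtain ⟨V, hV, hne⟩ := U2.exists_diagonalizing_of_not_phase hh
  set φ := tensor (fun _ : Fin n => V⁻¹) *ᵥ ψ with hφ
  have hφs : KetSym φ := hψ.tensor_const _
  have hφ0 : φ ≠ 0 := tensor_mulVec_ne_zero _ h0
  have haxis : ∀ r, (formPoly φ).IsRoot r → r = 0 := by
    intro r hr
    have h1 : form φ ![1, r] = 0 := by
      rw [form_eq_eval φ (by simp)]
      simp [show eval r (formPoly φ) = 0 from hr]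
    rw [hφ, form_mulVec] at h1
    obtain ⟨c, hc⟩ := hfix _ h1
    have h2 : ![1, r] ᵥ* (V⁻¹ * h * V).1 = c • ![1, r] := by
      rw [Matrix.UnitaryGroup.mul_val, Matrix.UnitaryGroup.mul_val, ← Matrix.vecMul_vecMul,
        ← Matrix.vecMul_vecMul, hc, Matrix.smul_vecMul, Matrix.vecMul_vecMul,
        ← Matrix.UnitaryGroup.mul_val, inv_mul_cancel, Matrix.UnitaryGroup.one_val,
        Matrix.vecMul_one]
    generalize (V⁻¹ * h * V) = D at *
    have e0 := congrFun h2 0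
    have e1 := congrFun h2 1
    simp [Matrix.vecMul, dotProduct, hV, (U2.offdiag_eq_zero_iff D).mpr hV] at e0 e1
    have h3 : r * (D.1 1 1 - D.1 0 0) = 0 := by rw [e0]; linear_combination e1
    exact (mul_eq_zero.mp h3).resolve_right (sub_ne_zero.mpr hne.symm)
  have hp0 := hφs.formPoly_ne_zero hφ0
  have hroots : (formPoly φ).roots = Multiset.replicate (Multiset.card (formPoly φ).roots) 0 := by
    rw [Multiset.eq_replicate_card]
    intro r hr
    exact haxis r ((Polynomial.mem_roots hp0).mp hr)
  have hsplit := (IsAlgClosed.splits (formPoly φ)).eq_prod_roots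
  rw [hroots, Multiset.map_replicate, Multiset.prod_replicate, C_0, sub_zero] at hsplit
  refine ⟨V⁻¹, Multiset.card (formPoly φ).roots, fun I hI => ?_⟩
  have hc := hφs.coeff_formPoly I
  rw [hsplit, coeff_C_mul_X_pow, if_neg hI, eq_comm, mul_eq_zero] at hc
  refine hc.resolve_left ?_
  exact_mod_cast (Nat.choose_pos (wt_le I)).ne'

end

/-! ### Stabilizer elements with different tensor factors -/

/-- Dividing a stabilizer element by its image under the transposition of two qubits leaves
`h ⊗ h⁻¹` on these qubits. -/
theorem KetSym.mulSingle_eq {ψ : Ket n} (hψ : KetSym ψ) {g : Fin n → U2}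
    (hg : toLU g ∈ stab (proj ψ)) {i j : Fin n} (hij : i ≠ j) :
    tensor (Pi.mulSingle i (g j * (g i)⁻¹)) *ᵥ ψ = tensor (Pi.mulSingle j (g j * (g i)⁻¹)) *ᵥ ψ := by
  obtain ⟨c, hc1, hc⟩ := (toLU_mem_stab g ψ).mp hg
  have hc' : tensor (g ∘ Equiv.swap i j) *ᵥ ψ = c • ψ := by
    funext I
    have : (I ∘ Equiv.swap i j) ∘ Equiv.swap i j = I := by
      funext k; simp
    rw [← this, hψ.mulVec_comp g, hc, this]
    simp only [Pi.smul_apply]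
    rw [hψ]
  have hc0 : c ≠ 0 := by rw [← norm_ne_zero_iff, hc1]; exact one_ne_zero
  have h1 : tensor (g * (g ∘ Equiv.swap i j)⁻¹) *ᵥ ψ = ψ := by
    have h2 : tensor (g * (g ∘ Equiv.swap i j)⁻¹) *ᵥ (c • ψ) = c • ψ := by
      rw [← hc', ← tensor_mul_mulVec, inv_mul_cancel_right, hc, hc']
    rw [Matrix.mulVec_smul] at h2
    exact smul_right_injective _ hc0 h2
  have h3 : g * (g ∘ Equiv.swap i j)⁻¹ =
      (Pi.mulSingle i (g j * (g i)⁻¹))⁻¹ * Pi.mulSingle j (g j * (g i)⁻¹) := by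
    funext k
    by_cases hk : k = i
    · subst hk; simp [hij]
    · by_cases hk' : k = j
      · subst hk'; simp [hij.symm]
      · simp [hk, hk', Equiv.swap_apply_of_ne_of_ne hk hk']
  rw [h3] at h1
  conv_lhs => rw [← h1]
  rw [← tensor_mul_mulVec, mul_inv_cancel_left]

/-- If the factors of a stabilizer element differ in `PU(2)`, then in an eigenbasis of their
quotient all mixed amplitudes vanish. -/
theorem KetSym.exists_ghz {ψ : Ket n} (hψ : KetSym ψ) {i j : Fin n} (hij : i ≠ j) {h : U2}
    (hh : h ∉ phases)
    (heq : tensor (Pi.mulSingle i h) *ᵥ ψ = tensor (Pi.mulSingle j h) *ᵥ ψ) :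
    ∃ (V : U2) (a b : ℂ), tensor (fun _ => V) *ᵥ ψ = ghzKet n a b := by
  obtain ⟨V, hV, hne⟩ := U2.exists_diagonalizing_of_not_phase hh
  set φ := tensor (fun _ : Fin n => V⁻¹) *ᵥ ψ with hφ
  have hφs : KetSym φ := hψ.tensor_const _
  have hcomm : ∀ i, tensor (Pi.mulSingle i (V⁻¹ * h * V)) *ᵥ φ =
      tensor (fun _ : Fin n => V⁻¹) *ᵥ (tensor (Pi.mulSingle i h) *ᵥ ψ) := by
    intro i
    rw [hφ, ← tensor_mul_mulVec, ← tensor_mul_mulVec]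
    congr 2
    funext k
    by_cases hk : k = i
    · subst hk; simp
    · simp [hk]
  have hD : tensor (Pi.mulSingle i (V⁻¹ * h * V)) *ᵥ φ =
      tensor (Pi.mulSingle j (V⁻¹ * h * V)) *ᵥ φ := by rw [hcomm, hcomm, heq]
  generalize (V⁻¹ * h * V) = D at *
  have hoff := (U2.offdiag_eq_zero_iff D).mpr hV
  have hdiag : ∀ (i : Fin n) I, (tensor (Pi.mulSingle i D) *ᵥ φ) I = D.1 (I i) (I i) * φ I := by
    intro i I
    rw [tensor_mulSingle_mulVec, Finset.sum_eq_single (I i)]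
    · simp
    · intro x _ hx
      generalize I i = y at *
      fin_cases x <;> fin_cases y <;> simp_all
    · simp
  have hzero : ∀ I, I i ≠ I j → φ I = 0 := by
    intro I hI
    have e := congrFun hD I
    rw [hdiag, hdiag] at e
    have : (D.1 (I i) (I i) - D.1 (I j) (I j)) * φ I = 0 := by linear_combination e
    refine (mul_eq_zero.mp this).resolve_left (sub_ne_zero.mpr ?_)
    generalize I i = x at *
    generalize I j = y at *
    fin_cases x <;> fin_cases y <;> simp_all [eq_comm]
  refine ⟨V⁻¹, φ 0, φ 1, ?_⟩
  rw [← hφ]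
  funext I
  by_cases hI0 : I = 0
  · subst hI0
    simp [ghzKet, zero_ne_one_bits (Fin.pos i)]
  by_cases hI1 : I = 1
  · subst hI1
    simp [ghzKet, (zero_ne_one_bits (Fin.pos i)).symm]
  have hr : ghzKet n (φ 0) (φ 1) I = 0 := by simp [ghzKet, hI0, hI1]
  rw [hr]
  by_cases hI : I i = I j
  · obtain ⟨l, hl⟩ : ∃ l, I l ≠ I i := by
      by_contra! hc
      rcases Fin.exists_fin_two.mp ⟨I i, rfl⟩ with h' | h'
      · exact hI0 (funext fun l => (hc l).trans h')
      · exact hI1 (funext fun l => (hc l).trans h')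
    have hli : l ≠ i := by rintro rfl; exact hl rfl
    rw [← hφs (Equiv.swap j l) I]
    apply hzero
    simp only [Function.comp_apply, Equiv.swap_apply_left]
    rw [Equiv.swap_apply_of_ne_of_ne hij hli.symm]
    exact hl.symm
  · exact hzero I hI

/-! ### Reduction to the normal forms -/

theorem OfFamily.of_luEquiv {ρ σ : QMatrix n} {F : Family} (h : LUEquiv ρ σ) :
    OfFamily F ρ → OfFamily F σ := by
  rintro ⟨τ, hτ, h'⟩
  exact ⟨τ, hτ, h'.trans h⟩

theorem exists_phase (a : ℂ) : ∃ z : Circle, (z : ℂ) * a = (‖a‖ : ℂ) := by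
  by_cases ha : a = 0
  · exact ⟨1, by simp [ha]⟩
  · have hn : (‖a‖ : ℂ) ≠ 0 := by simpa using ha
    refine ⟨⟨(‖a‖ : ℂ) / a, mem_sphere_zero_iff_norm.mpr ?_⟩, ?_⟩
    · rw [norm_div, Complex.norm_real, norm_norm, div_self (norm_ne_zero_iff.mpr ha)]
    · exact div_mul_cancel₀ _ ha

theorem luEquiv_ghz_norm (hn : 1 ≤ n) (a b : ℂ) :
    LUEquiv (proj (ghzKet n a b)) (proj (ghzKet n (‖a‖ : ℂ) (‖b‖ : ℂ))) := by
  obtain ⟨z, hz⟩ := exists_phase a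
  obtain ⟨w, hw⟩ := exists_phase b
  let j : Fin n := ⟨0, hn⟩
  refine luEquiv_of_mulVec (Pi.mulSingle j (diagU z w)) (c := 1) (by simp) ?_
  rw [one_smul]
  funext I
  have hdiag : ∀ k, ((Pi.mulSingle j (diagU z w) : Fin n → U2) k).1 1 0 = 0 := by
    intro k
    by_cases hk : k = j
    · subst hk; simp
    · simp [hk]
  rw [tensor_diag_mulVec hdiag, Finset.prod_eq_single j]
  · by_cases h0 : I = 0
    · subst h0
      simpa [ghzKet, zero_ne_one_bits hn] using hz
    · by_cases h1 : I = 1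
      · subst h1
        simpa [ghzKet, (zero_ne_one_bits hn).symm] using hw
      · simp [ghzKet, h0, h1]
  · intro k _ hk
    simp [hk]
  · simp

theorem flip_ghz (a b : ℂ) : tensor (fun _ : Fin n => flipX) *ᵥ ghzKet n a b = ghzKet n b a := by
  funext I
  rw [tensor_flip_mulVec]
  have h0 : (fun k => 1 - I k) = 0 ↔ I = 1 := by
    simp only [funext_iff, Pi.zero_apply, Pi.one_apply, sub_eq_zero]
    exact forall_congr' fun _ => eq_comm
  have h1 : (fun k => 1 - I k) = 1 ↔ I = 0 := by
    simp only [funext_iff, Pi.zero_apply, Pi.one_apply, sub_eq_self]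
  simp only [ghzKet, Pi.add_apply, Pi.single_apply, h0, h1]
  rw [add_comm]

theorem luEquiv_ghz_swap (a b : ℂ) : LUEquiv (proj (ghzKet n a b)) (proj (ghzKet n b a)) :=
  luEquiv_of_mulVec _ (c := 1) (by simp) (by rw [flip_ghz, one_smul])

theorem singletKet_apply (I : Fin 2 → Fin 2) : singletKet I =
    ((1 / √2 : ℝ) : ℂ) * ((if I 0 = 0 ∧ I 1 = 1 then 1 else 0) -
      (if I 0 = 1 ∧ I 1 = 0 then 1 else 0)) := by
  have h1 : I = ![0, 1] ↔ I 0 = 0 ∧ I 1 = 1 := by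
    rw [funext_iff, Fin.forall_fin_two]; simp
  have h2 : I = ![1, 0] ↔ I 0 = 1 ∧ I 1 = 0 := by
    rw [funext_iff, Fin.forall_fin_two]; simp
  simp only [singletKet, Pi.smul_apply, Pi.sub_apply, Pi.single_apply, h1, h2, smul_eq_mul]

theorem bits_two (I : Fin 2 → Fin 2) :
    I = ![0, 0] ∨ I = ![0, 1] ∨ I = ![1, 0] ∨ I = ![1, 1] := by
  revert I; decide

theorem luEquiv_ghz_singlet :
    LUEquiv (proj (ghzKet 2 ((1 / √2 : ℝ) : ℂ) ((1 / √2 : ℝ) : ℂ))) (proj singletKet) := by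
  obtain ⟨V, hV⟩ := exists_U2 (a := 0) (b := -1) (by simp)
  refine luEquiv_of_mulVec (Pi.mulSingle 0 V) (c := 1) (by simp) ?_
  rw [one_smul]
  funext I
  rw [tensor_mulSingle_mulVec, Fin.sum_univ_two, hV, singletKet_apply]
  simp only [ghzKet, Pi.add_apply, Pi.single_apply, funext_iff, Fin.forall_fin_two]
  rcases bits_two I with rfl | rfl | rfl | rfl <;> simp

theorem luEquiv_dicke_singlet : LUEquiv (proj (dickeKet 2 1)) (proj singletKet) := by
  obtain ⟨V, hV⟩ : ∃ V : U2, V.1 = !![1, 0; 0, -1] := by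
    refine ⟨⟨!![1, 0; 0, -1], ?_⟩, rfl⟩
    rw [Matrix.mem_unitaryGroup_iff]
    ext i j
    fin_cases i <;> fin_cases j <;> simp [Matrix.mul_apply, Matrix.star_apply]
  refine luEquiv_of_mulVec (Pi.mulSingle 0 V) (c := 1) (by simp) ?_
  rw [one_smul]
  funext I
  rw [tensor_mulSingle_mulVec, Fin.sum_univ_two, hV, singletKet_apply]
  simp only [dickeKet_apply, wt, Fin.sum_univ_two]
  rcases bits_two I with rfl | rfl | rfl | rfl <;> simp

theorem trace_proj_singlet : (proj singletKet).trace = 1 := by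
  rw [← trace_proj_dicke (n := 2) (k := 1) (by norm_num)]
  obtain ⟨U, hU⟩ := luEquiv_dicke_singlet
  obtain ⟨g, rfl⟩ := exists_toLU U
  rw [← hU, act_proj, trace_proj_mulVec]

theorem exists_ofFamily_ghz (hn : 2 ≤ n) {a b : ℂ} (h : ‖a‖ ^ 2 + ‖b‖ ^ 2 = 1) :
    ∃ F, OfFamily F (proj (ghzKet n a b)) := by
  have hprod : ∀ a : ℂ, ‖a‖ = 1 → OfFamily .product (proj (ghzKet n a 0)) := by
    intro a ha
    refine ⟨_, rfl, ?_⟩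
    have := luEquiv_ghz_norm (n := n) (by omega) a 0
    rw [ha, norm_zero] at this
    rw [productKet_eq]
    exact_mod_cast this.symm
  by_cases ha : a = 0
  · refine ⟨.product, (hprod b ?_).of_luEquiv ?_⟩
    · rw [ha] at h
      simp only [norm_zero] at h
      nlinarith [norm_nonneg b]
    · rw [ha]
      exact luEquiv_ghz_swap _ _
  by_cases hb : b = 0
  · subst hb
    refine ⟨.product, hprod a ?_⟩
    simp only [norm_zero] at h
    nlinarith [norm_nonneg a]
  by_cases hab : ‖a‖ = ‖b‖
  · have hv : ‖b‖ = 1 / √2 := by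
      rw [hab] at h
      rw [one_div, ← Real.sqrt_inv, eq_comm, Real.sqrt_eq_iff_mul_self_eq_of_pos (norm_pos_iff.mpr hb)]
      linarith
    have h1 := luEquiv_ghz_norm (n := n) (by omega) a b
    rw [hab, hv] at h1
    rcases hn.eq_or_lt with rfl | hn3
    · exact ⟨.singlet, _, rfl, (h1.trans luEquiv_ghz_singlet).symm⟩
    · exact ⟨.ghz, _, ⟨hn3, rfl⟩, h1.symm⟩
  · exact ⟨.genGHZ, _, ⟨hn, a, b, ha, hb, hab, h, rfl⟩, LUEquiv.refl _⟩

theorem dickeKet_zero (n : ℕ) : dickeKet n 0 = productKet n := by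
  funext I
  have : wt I = 0 ↔ I = 0 := by
    simp [wt, Finset.sum_eq_zero_iff, funext_iff]
  simp [dickeKet_apply, productKet, Pi.single_apply, this]

theorem wt_flip (I : Fin n → Fin 2) : wt (fun k => 1 - I k) + wt I = n := by
  rw [wt, wt, ← Finset.sum_add_distrib]
  have : ∀ j, ((1 - I j : Fin 2) : ℕ) + (I j : ℕ) = 1 := by
    intro j
    generalize I j = x
    fin_cases x <;> simp
  simp [this]

theorem flip_dicke {k : ℕ} (hk : k ≤ n) :
    tensor (fun _ : Fin n => flipX) *ᵥ dickeKet n k = dickeKet n (n - k) := by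
  funext I
  rw [tensor_flip_mulVec, dickeKet_apply, dickeKet_apply, Nat.choose_symm hk]
  have := wt_flip I
  have h : wt (fun k => 1 - I k) = k ↔ wt I = n - k := by omega
  simp only [h]

theorem luEquiv_dicke_flip {k : ℕ} (hk : k ≤ n) :
    LUEquiv (proj (dickeKet n k)) (proj (dickeKet n (n - k))) :=
  luEquiv_of_mulVec _ (c := 1) (by simp) (by rw [flip_dicke hk, one_smul])

theorem exists_ofFamily_dicke {k : ℕ} (hk : k ≤ n) : ∃ F, OfFamily F (proj (dickeKet n k)) := by
  by_cases h0 : k = 0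
  · subst h0
    rw [dickeKet_zero]
    exact ⟨.product, _, rfl, LUEquiv.refl _⟩
  by_cases hkn : k = n
  · subst hkn
    refine ⟨.product, _, rfl, ?_⟩
    have := (luEquiv_dicke_flip le_rfl (n := k) (k := k)).symm
    rwa [Nat.sub_self, dickeKet_zero] at this
  by_cases h2 : 2 * k = n
  · by_cases hn : n = 2
    · subst hn
      obtain rfl : k = 1 := by omega
      exact ⟨.singlet, _, rfl, luEquiv_dicke_singlet.symm⟩
    · obtain rfl : k = n / 2 := by omega
      exact ⟨.dickeHalf, _, ⟨by omega, ⟨n / 2, by omega⟩, rfl⟩, LUEquiv.refl _⟩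
  · exact ⟨.dicke, _, ⟨by omega, k, by omega, by omega, h2, rfl⟩, LUEquiv.refl _⟩

theorem exists_ofFamily_of_ketSym {ψ : Ket n} (hn : n ≠ 0) (hψ : KetSym ψ)
    (ht : (proj ψ).trace = 1) (hinf : Infinite (stab (proj ψ))) :
    ∃ F, OfFamily F (proj ψ) := by
  have h0 : ψ ≠ 0 := by
    rintro rfl
    simp [proj] at ht
  by_cases hconst : ∀ g : Fin n → U2, toLU g ∈ stab (proj ψ) → ∃ h : U2, toLU g = toLU fun _ => h
  · obtain ⟨h, hh, hfix⟩ := hψ.exists_fixing_zeroLines h0 hinf hconst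
    obtain ⟨V, m, hm⟩ := hψ.exists_single_weight h0 hh hfix
    set φ := tensor (fun _ : Fin n => V) *ᵥ ψ with hφ
    have hφ0 : φ ≠ 0 := tensor_mulVec_ne_zero _ h0
    obtain ⟨K, hK⟩ := Function.ne_iff.mp hφ0
    have hKm : wt K = m := by
      by_contra hc
      exact hK (hm K hc)
    have hmn : m ≤ n := hKm ▸ wt_le K
    have hd := dicke_amp_ne_zero hmn
    have heq : φ = (φ K / ((1 / √(n.choose m : ℝ) : ℝ) : ℂ)) • dickeKet n m := by
      funext I
      rw [Pi.smul_apply, dickeKet_apply, smul_eq_mul]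
      split_ifs with hI
      · rw [div_mul_cancel₀ _ hd]
        exact (hψ.tensor_const V).eq_of_wt (hI.trans hKm.symm)
      · rw [hm I hI, mul_zero]
    have htφ : (proj φ).trace = 1 := by rw [hφ, trace_proj_mulVec, ht]
    have hc := norm_eq_one_of_trace heq htφ (trace_proj_dicke hmn)
    obtain ⟨F, hF⟩ := exists_ofFamily_dicke hmn
    exact ⟨F, hF.of_luEquiv (luEquiv_of_mulVec _ hc (hφ.symm.trans heq)).symm⟩
  · push Not at hconst
    obtain ⟨g, hg, hne⟩ := hconst
    let i : Fin n := ⟨0, by omega⟩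
    obtain ⟨j, hj⟩ : ∃ j, g j * (g i)⁻¹ ∉ phases := by
      by_contra! hc
      apply hne (g i)
      funext j
      have h1 := (QuotientGroup.eq_one_iff _).mpr (hc j)
      rw [QuotientGroup.mk_mul, QuotientGroup.mk_inv, mul_inv_eq_one] at h1
      exact h1
    have hij : i ≠ j := by
      rintro rfl
      apply hj
      rw [mul_inv_cancel]
      exact phases.one_mem
    obtain ⟨V, a, b, hV⟩ := hψ.exists_ghz hij hj (hψ.mulSingle_eq hg hij)
    have hn2 : 2 ≤ n := by
      have h1 : 1 < Fintype.card (Fin n) := Fintype.one_lt_card_iff.mpr ⟨i, j, hij⟩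
      rwa [Fintype.card_fin] at h1
    have hab : ‖a‖ ^ 2 + ‖b‖ ^ 2 = 1 := by
      rw [← trace_proj_ghz (n := n) (by omega), ← hV, trace_proj_mulVec, ht]
    obtain ⟨F, hF⟩ := exists_ofFamily_ghz hn2 hab
    exact ⟨F, hF.of_luEquiv
      (luEquiv_of_mulVec _ (c := 1) (by simp) (by rw [hV, one_smul])).symm⟩

/-- On two qubits, exchange invariance of the projector makes the amplitude vector symmetric or
antisymmetric. -/
theorem ketSym_or_singlet {ψ : Ket 2} (h : IsSymmetric (proj ψ)) (ht : (proj ψ).trace = 1) :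
    KetSym ψ ∨ OfFamily .singlet (proj ψ) := by
  have hsw : proj (fun I => ψ (I ∘ Equiv.swap 0 1)) = proj ψ := h (Equiv.swap 0 1)
  obtain ⟨c, -, hc⟩ := exists_smul_of_proj_eq hsw
  have hc' : ∀ I, ψ (I ∘ Equiv.swap 0 1) = c * ψ I := fun I => congrFun hc I
  have hinv : ∀ I : Fin 2 → Fin 2, (I ∘ Equiv.swap 0 1) ∘ Equiv.swap 0 1 = I := by
    intro I; funext k; simp
  have hψ0 : ψ ≠ 0 := by
    rintro rfl
    simp [proj] at ht
  obtain ⟨K, hK⟩ := Function.ne_iff.mp hψ0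
  have hsq : c * c = 1 := by
    have := hc' (K ∘ Equiv.swap 0 1)
    rw [hinv, hc'] at this
    exact mul_right_cancel₀ hK (by linear_combination -this)
  rcases mul_self_eq_one_iff.mp hsq with rfl | rfl
  · left
    intro π I
    have hπ : ∀ π : Equiv.Perm (Fin 2), π = 1 ∨ π = Equiv.swap 0 1 := by decide
    rcases hπ π with rfl | rfl
    · rfl
    · rw [hc', one_mul]
  · right
    have hsame : ∀ x : Fin 2, ψ ![x, x] = 0 := by
      intro x
      have h1 := hc' ![x, x]
      have : ![x, x] ∘ Equiv.swap 0 1 = ![x, x] := by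
        funext k; fin_cases k <;> rfl
      rw [this] at h1
      linear_combination h1 / 2
    have h10 : ψ ![1, 0] = -ψ ![0, 1] := by
      have h1 := hc' ![0, 1]
      have : ![(0 : Fin 2), 1] ∘ Equiv.swap 0 1 = ![1, 0] := by
        funext k; fin_cases k <;> rfl
      rw [this] at h1
      linear_combination h1
    have hs2 : ((√2 : ℝ) : ℂ) ≠ 0 := by simp
    have heq : ψ = (ψ ![0, 1] * ((√2 : ℝ) : ℂ)) • singletKet := by
      funext I
      rw [Pi.smul_apply, singletKet_apply, smul_eq_mul]
      rcases bits_two I with rfl | rfl | rfl | rfl <;> simp [hsame, h10]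
    have hc1 := norm_eq_one_of_trace heq ht trace_proj_singlet
    refine ⟨_, rfl, ?_⟩
    rw [heq, proj_smul hc1]
    exact LUEquiv.refl _

theorem exists_ofFamily {ρ : QMatrix n} (hp : IsPure ρ) (hs : IsSymmetric ρ)
    (hinf : Infinite (stab ρ)) : ∃ F, OfFamily F ρ := by
  have hn : n ≠ 0 := by
    rintro rfl
    exact not_finite (stab ρ)
  obtain ⟨ψ, rfl⟩ := exists_ket_of_isPure hp
  have ht := hp.1.2
  by_cases h2 : n = 2
  · subst h2
    rcases ketSym_or_singlet hs ht with hψ | hψ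
    · exact exists_ofFamily_of_ketSym hn hψ ht hinf
    · exact ⟨_, hψ⟩
  · exact exists_ofFamily_of_ketSym hn (ketSym_of_isSymmetric h2 hs) ht hinf

/-! ### Isomorphisms onto stabilizers -/

/-- Conjugation by `U` as an isomorphism between the stabilizers of `τ` and of `UτU†`. -/
noncomputable def stabConj (U : LU n) (τ : QMatrix n) : stab τ ≃* stab (act U τ) where
  toFun x := ⟨U * x.1 * U⁻¹, by
    have hx : act x.1 τ = τ := x.2
    rw [mem_stab, ← act_mul, inv_mul_cancel_right, act_mul, hx]⟩
  invFun y := ⟨U⁻¹ * y.1 * U, by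
    have hy : act y.1 (act U τ) = act U τ := y.2
    rw [mem_stab, act_mul, act_mul, hy, ← act_mul, inv_mul_cancel, act_one]⟩
  left_inv x := by
    apply Subtype.ext
    show U⁻¹ * (U * x.1 * U⁻¹) * U = x.1
    group
  right_inv y := by
    apply Subtype.ext
    show U * (U⁻¹ * y.1 * U) * U⁻¹ = y.1
    group
  map_mul' x y := by
    apply Subtype.ext
    show U * (x.1 * y.1) * U⁻¹ = (U * x.1 * U⁻¹) * (U * y.1 * U⁻¹)
    group

theorem stabilizerIso_of_hom {G P : Type} [Group G] {param : P → G} {img : P → LU n}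
    {τ : QMatrix n} (φ : G →* LU n) (hinj : Function.Injective φ)
    (hrange : ∀ U, U ∈ stab τ ↔ ∃ z, φ z = U) (himg : ∀ p, φ (param p) = img p) :
    StabilizerIso G param img τ := by
  have hr : φ.range = stab τ := by
    ext U
    rw [MonoidHom.mem_range, hrange]
  let e : G ≃* stab τ := (MonoidHom.ofInjective hinj).trans (MulEquiv.subgroupCongr hr)
  have he : ∀ z, (e z : LU n) = φ z := fun z => rfl
  refine ⟨e, fun p => (he _).trans (himg p), fun U => ⟨e.trans (stabConj U τ), fun z => rfl⟩⟩

/-- The homomorphism from the dihedral extension of `A` determined by a homomorphism on `A` and an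
involution `s` that inverts its image. -/
def dihHom {A H : Type} [CommGroup A] [Group H] (f : A →* H) (s : H) (hs : s * s = 1)
    (hsf : ∀ a, s * f a = (f a)⁻¹ * s) : Dih A →* H where
  toFun x := f x.left * s ^ bit x.right
  map_one' := by simp [bit]
  map_mul' := by
    have h2 : ∀ b : Z2, b = 1 ∨ b = Multiplicative.ofAdd 1 := by decide
    have h3 : (Multiplicative.ofAdd 1 : Z2) ≠ 1 := by decide
    have h4 : (Multiplicative.ofAdd 1 : Z2) * Multiplicative.ofAdd 1 = 1 := by decide
    have b0 : bit 1 = 0 := by decide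
    have b1 : bit (Multiplicative.ofAdd 1) = 1 := by decide
    rintro ⟨a, b⟩ ⟨c, d⟩
    simp only [SemidirectProduct.mul_left, SemidirectProduct.mul_right]
    rcases h2 b with rfl | rfl
    · rcases h2 d with rfl | rfl <;> simp [invAction, b0, b1, mul_assoc]
    · have e : (invAction A (Multiplicative.ofAdd 1)) c = c⁻¹ := by simp [invAction, h3]
      rw [e]
      rcases h2 d with rfl | rfl
      · simp only [mul_one, b1, b0, pow_one, pow_zero, map_mul, map_inv, mul_assoc, hsf]
      · simp only [h4, b0, b1, pow_one, pow_zero, mul_one, map_mul, map_inv]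
        rw [mul_assoc, ← mul_assoc s, hsf, mul_assoc, hs, mul_one]

theorem dihHom_apply {A H : Type} [CommGroup A] [Group H] (f : A →* H) (s : H) (hs : s * s = 1)
    (hsf : ∀ a, s * f a = (f a)⁻¹ * s) (x : Dih A) :
    dihHom f s hs hsf x = f x.left * s ^ bit x.right := rfl

theorem bit_cases (b : Z2) : (b = 1 ∧ bit b = 0) ∨ (b = Multiplicative.ofAdd 1 ∧ bit b = 1) := by
  revert b; decide

theorem dihHom_injective {A H : Type} [CommGroup A] [Group H] (f : A →* H) (s : H)
    (hs : s * s = 1) (hsf : ∀ a, s * f a = (f a)⁻¹ * s) (hf : Function.Injective f)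
    (hns : ∀ a, f a ≠ s) : Function.Injective (dihHom f s hs hsf) := by
  rw [injective_iff_map_eq_one]
  rintro ⟨a, b⟩ h
  rw [dihHom_apply] at h
  rcases bit_cases b with ⟨rfl, hb⟩ | ⟨rfl, hb⟩
  · rw [hb, pow_zero, mul_one] at h
    rw [(injective_iff_map_eq_one f).mp hf a h]
    rfl
  · rw [hb, pow_one] at h
    refine absurd ?_ (hns a)
    rw [eq_inv_of_mul_eq_one_left h]
    exact inv_eq_of_mul_eq_one_left hs

theorem exists_dihHom_iff {A H : Type} [CommGroup A] [Group H] (f : A →* H) (s : H)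
    (hs : s * s = 1) (hsf : ∀ a, s * f a = (f a)⁻¹ * s) (x : H) :
    (∃ z, dihHom f s hs hsf z = x) ↔ (∃ a, f a = x) ∨ ∃ a, f a = x * s := by
  constructor
  · rintro ⟨⟨a, b⟩, rfl⟩
    rw [dihHom_apply]
    rcases bit_cases b with ⟨rfl, hb⟩ | ⟨rfl, hb⟩
    · left; exact ⟨a, by simp [hb]⟩
    · right; exact ⟨a, by simp [hb, mul_assoc, hs]⟩
  · rintro (⟨a, rfl⟩ | ⟨a, ha⟩)
    · exact ⟨⟨a, 1⟩, by simp [dihHom_apply, bit]⟩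
    · refine ⟨⟨a, Multiplicative.ofAdd 1⟩, ?_⟩
      have b1 : bit (Multiplicative.ofAdd 1) = 1 := by decide
      rw [dihHom_apply]
      simp only [b1, pow_one]
      rw [ha, mul_assoc, hs, mul_one]

/-! ### The torus of local unitaries -/

/-- The torus of classes of diagonal matrices in `PU(2)^n`. -/
noncomputable def torusHom (n : ℕ) : (Fin n → Circle) →* LU n where
  toFun z k := torus (z k)
  map_one' := by funext k; simp
  map_mul' z w := by funext k; simp

theorem torusHom_eq_toLU (z : Fin n → Circle) : torusHom n z = toLU fun k => diagU 1 (z k) := rfl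

theorem torusHom_injective (n : ℕ) : Function.Injective (torusHom n) := by
  intro z w h
  funext k
  exact torus_injective (congrFun h k)

theorem torusHom_exp (t : Fin n → ℝ) :
    torusHom n (fun k => Circle.exp (t k)) = toLU fun k => rotZ (t k) := by
  funext k
  exact torus_exp (t k)

theorem exists_torusHom {g : Fin n → U2} (hg : ∀ k, (g k).1 1 0 = 0) :
    ∃ z, torusHom n z = toLU g := by
  choose z hz using fun k => exists_torus_of_offdiag (hg k)
  exact ⟨z, funext hz⟩

theorem offdiag_of_torus_eq {g : U2} {z : Circle} (h : torus z = QuotientGroup.mk g) :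
    g.1 1 0 = 0 := by
  rw [torus_apply, QuotientGroup.eq, mem_phases_iff] at h
  have := h.1
  rw [Matrix.UnitaryGroup.mul_val, Matrix.UnitaryGroup.inv_val] at this
  simpa [Matrix.mul_apply, Matrix.star_apply] using this

theorem flipAll_mul_self (n : ℕ) : flipAll n * flipAll n = 1 := by
  rw [flipAll, ← toLU_mul]
  have : ((fun _ => flipX : Fin n → U2) * fun _ => flipX) = 1 := by
    funext k
    exact flipX_mul_self
  rw [this]
  rfl

theorem flipAll_torusHom (z : Fin n → Circle) :
    flipAll n * torusHom n z = (torusHom n z)⁻¹ * flipAll n := by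
  funext k
  exact flipX_torus (z k)

theorem torusHom_ne_flipAll (hn : 1 ≤ n) (z : Fin n → Circle) : torusHom n z ≠ flipAll n := by
  intro h
  have := offdiag_of_torus_eq (congrFun h ⟨0, hn⟩)
  simp [flipX_val] at this

theorem mul_flipX_val (g : U2) (i j : Fin 2) : (g * flipX).1 i j = g.1 i (1 - j) := by
  rw [Matrix.UnitaryGroup.mul_val, flipX_val, Matrix.mul_apply, Fin.sum_univ_two]
  fin_cases j <;> simp

theorem exists_torusHom_flip {g : Fin n → U2} (hg : ∀ k, (g k).1 0 0 = 0) :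
    ∃ z, torusHom n z = toLU g * flipAll n := by
  rw [flipAll, ← toLU_mul]
  apply exists_torusHom
  intro k
  rw [Pi.mul_apply, mul_flipX_val]
  exact (U2.diag_eq_zero_iff (g k)).mp (hg k)

theorem tensor_torus_mulVec (z : Fin n → Circle) (ψ : Ket n) (I : Fin n → Fin 2) :
    (tensor (fun k => diagU 1 (z k)) *ᵥ ψ) I = (∏ k, (z k : ℂ) ^ (I k : ℕ)) * ψ I := by
  rw [tensor_diag_mulVec (by simp)]
  congr 2
  funext k
  generalize I k = x
  fin_cases x <;> simp

/-! ### The stabilizer of a product state -/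

theorem stabilizerIso_product (n : ℕ) :
    StabilizerIso (Fin n → Circle) (fun (t : Fin n → ℝ) k => Circle.exp (t k))
      (fun t => rotEach t) (proj (productKet n)) := by
  refine stabilizerIso_of_hom (torusHom n) (torusHom_injective n) (fun U => ⟨?_, ?_⟩) torusHom_exp
  · intro hU
    obtain ⟨g, rfl⟩ := exists_toLU U
    obtain ⟨c, hc1, hc⟩ := (toLU_mem_stab _ _).mp hU
    apply exists_torusHom
    have hent : ∀ I, ∏ k, (g k).1 (I k) 0 = c * (Pi.single 0 1 : Ket n) I := by
      intro I
      have := congrFun hc I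
      rw [productKet, tensor_single_mulVec, one_mul] at this
      exact this
    have h00 : ∀ k, (g k).1 0 0 ≠ 0 := by
      have := hent 0
      simp only [Pi.zero_apply, Pi.single_eq_same, mul_one] at this
      have hc0 : c ≠ 0 := by rw [← norm_ne_zero_iff, hc1]; exact one_ne_zero
      intro k
      rw [← this] at hc0
      exact Finset.prod_ne_zero_iff.mp hc0 k (Finset.mem_univ k)
    intro j
    have h1 := hent (Pi.single j 1)
    have hne : (Pi.single j 1 : Fin n → Fin 2) ≠ 0 := by simp
    rw [Pi.single_eq_of_ne hne, mul_zero, Finset.prod_eq_zero_iff] at h1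
    obtain ⟨k, -, hk⟩ := h1
    by_cases hkj : k = j
    · subst hkj; simpa using hk
    · rw [Pi.single_eq_of_ne hkj] at hk
      exact absurd hk (h00 k)
  · rintro ⟨z, rfl⟩
    rw [torusHom_eq_toLU, toLU_mem_stab]
    refine ⟨1, by simp, ?_⟩
    funext I
    rw [tensor_torus_mulVec, one_smul]
    by_cases h0 : I = 0
    · subst h0; simp
    · simp [productKet, h0]

/-! ### The stabilizer of a generalized GHZ state -/

/-- The embedding of `U(1)^(n-1)` as the kernel of the product map on `U(1)^n`; the last
coordinate is determined by the others. -/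
noncomputable def balancedHom (n : ℕ) : (Fin (n - 1) → Circle) →* (Fin n → Circle) where
  toFun z k := if h : (k : ℕ) < n - 1 then z ⟨k, h⟩ else (∏ j, z j)⁻¹
  map_one' := by funext k; simp
  map_mul' z w := by
    funext k
    by_cases h : (k : ℕ) < n - 1 <;> simp [h, Finset.prod_mul_distrib, mul_comm]

theorem balancedHom_apply (z : Fin (n - 1) → Circle) (k : Fin n) :
    balancedHom n z k = if h : (k : ℕ) < n - 1 then z ⟨k, h⟩ else (∏ j, z j)⁻¹ := rfl

theorem balancedHom_injective (n : ℕ) : Function.Injective (balancedHom n) := by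
  intro z w h
  funext k
  have := congrFun h ⟨k, by omega⟩
  rw [balancedHom_apply, balancedHom_apply] at this
  simpa using this

theorem exists_balancedHom_iff (hn : 1 ≤ n) (z : Fin n → Circle) :
    (∃ w, balancedHom n w = z) ↔ ∏ k, z k = 1 := by
  obtain ⟨m, rfl⟩ : ∃ m, n = m + 1 := ⟨n - 1, by omega⟩
  constructor
  · rintro ⟨w, rfl⟩
    rw [Fin.prod_univ_castSucc]
    simp only [balancedHom_apply, Fin.val_castSucc, Fin.val_last, Nat.add_sub_cancel, Fin.is_lt,
      dite_true, lt_irrefl, dite_false, Fin.eta]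
    exact mul_inv_cancel _
  · intro h
    refine ⟨fun j => z (Fin.castSucc j), ?_⟩
    funext k
    rw [balancedHom_apply]
    induction k using Fin.lastCases with
    | last =>
      rw [Fin.prod_univ_castSucc] at h
      simp only [Fin.val_last, Nat.add_sub_cancel, lt_irrefl, dite_false]
      exact inv_eq_of_mul_eq_one_right h
    | cast j =>
      simp

theorem torusHom_balancedHom_exp (t : Fin (n - 1) → ℝ) :
    torusHom n (balancedHom n fun k => Circle.exp (t k)) = rotBalanced t := by
  have : (balancedHom n fun k => Circle.exp (t k)) =
      fun k : Fin n => Circle.exp (if h : (k : ℕ) < n - 1 then t ⟨k, h⟩ else -∑ j, t j) := by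
    funext k
    rw [balancedHom_apply]
    split_ifs
    · rfl
    · rw [Circle.exp_neg, _root_.inv_inj]
      exact (map_sum Circle.expHom t Finset.univ).symm
  rw [this, torusHom_exp, rotBalanced]
  congr 1
  funext k
  split_ifs <;> rfl

theorem torusHom_mem_stab_ghz (hn : 1 ≤ n) {a b : ℂ} (ha : a ≠ 0) (hb : b ≠ 0)
    (z : Fin n → Circle) : torusHom n z ∈ stab (proj (ghzKet n a b)) ↔ ∏ k, z k = 1 := by
  have h01 := zero_ne_one_bits hn
  rw [torusHom_eq_toLU, toLU_mem_stab]
  constructor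
  · rintro ⟨c, -, hc⟩
    have e0 := congrFun hc 0
    have e1 := congrFun hc 1
    rw [tensor_torus_mulVec] at e0 e1
    simp [ghzKet, h01, h01.symm, ha, hb] at e0 e1
    apply Circle.ext
    rw [Circle.coe_one, ← e0] at *
    rw [← e1]
    exact map_prod Circle.coeHom z Finset.univ
  · intro h
    refine ⟨1, by simp, ?_⟩
    funext I
    rw [tensor_torus_mulVec, one_smul]
    by_cases h0 : I = 0
    · subst h0; simp
    by_cases h1 : I = 1
    · subst h1
      have : ∏ k, (z k : ℂ) = 1 := by
        rw [← Circle.coe_one, ← h]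
        exact (map_prod Circle.coeHom z Finset.univ).symm
      simp [this]
    · simp [ghzKet, h0, h1]

theorem exists_balanced_torusHom_iff (hn : 1 ≤ n) {a b : ℂ} (ha : a ≠ 0) (hb : b ≠ 0)
    (U : LU n) : (∃ w, (torusHom n).comp (balancedHom n) w = U) ↔
      U ∈ stab (proj (ghzKet n a b)) ∧ ∃ z, torusHom n z = U := by
  constructor
  · rintro ⟨w, rfl⟩
    exact ⟨(torusHom_mem_stab_ghz hn ha hb _).mpr ((exists_balancedHom_iff hn _).mp ⟨w, rfl⟩),
      _, rfl⟩
  · rintro ⟨hU, z, rfl⟩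
    obtain ⟨w, rfl⟩ := (exists_balancedHom_iff hn z).mpr ((torusHom_mem_stab_ghz hn ha hb z).mp hU)
    exact ⟨w, rfl⟩

/-- Moving some of the tensor factors of a stabilizer element to the other side. -/
theorem mulVec_eq_of_mul {ψ : Ket n} {c : ℂ} {A B : Fin n → U2}
    (h : tensor (A * B) *ᵥ ψ = c • ψ) : tensor B *ᵥ ψ = c • (tensor A⁻¹ *ᵥ ψ) := by
  rw [← tensor_inv_mulVec A (tensor B *ᵥ ψ), ← tensor_mul_mulVec A, h, Matrix.mulVec_smul]

/-- If `|a| ≠ |b|`, a stabilizer element is diagonal in each tensor factor: comparing the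
amplitudes of `g_j⁻¹ ψ` and of the remaining factors applied to `ψ` gives two incompatible
proportions unless the off-diagonal entries of `g_j` vanish. -/
theorem offdiag_of_mem_stab_ghz (hn : 2 ≤ n) {a b : ℂ} (hab : ‖a‖ ≠ ‖b‖) {g : Fin n → U2}
    (hg : toLU g ∈ stab (proj (ghzKet n a b))) (j : Fin n) : (g j).1 1 0 = 0 := by
  obtain ⟨c, hc1, hc⟩ := (toLU_mem_stab _ _).mp hg
  obtain ⟨l, hl⟩ : ∃ l : Fin n, l ≠ j := by
    have : Nontrivial (Fin n) := Fin.nontrivial_iff_two_le.mpr hn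
    exact exists_ne j
  have hsplit : g = Pi.mulSingle j (g j) * Function.update g j 1 := by
    funext k
    by_cases hk : k = j
    · subst hk; simp
    · simp [hk]
  rw [hsplit] at hc
  have hc := mulVec_eq_of_mul hc
  rw [← Pi.mulSingle_inv] at hc
  have hupd : ∀ m x : Fin 2, ghzKet n a b (Function.update (fun _ => m) j x) =
      if x = m then (if m = 0 then a else b) else 0 := by
    intro m x
    have h0 : Function.update (fun _ : Fin n => m) j x = 0 ↔ x = 0 ∧ m = 0 := by
      constructor
      · intro h
        exact ⟨by simpa using congrFun h j, by simpa [hl] using congrFun h l⟩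
      · rintro ⟨rfl, rfl⟩
        exact Function.update_eq_self j _
    have h1 : Function.update (fun _ : Fin n => m) j x = 1 ↔ x = 1 ∧ m = 1 := by
      constructor
      · intro h
        exact ⟨by simpa using congrFun h j, by simpa [hl] using congrFun h l⟩
      · rintro ⟨rfl, rfl⟩
        exact Function.update_eq_self j _
    simp only [ghzKet, Pi.add_apply, Pi.single_apply, h0, h1]
    fin_cases m <;> fin_cases x <;> simp
  have e01 := congrFun hc (Function.update (fun _ => 1) j 0)
  have e10 := congrFun hc (Function.update (fun _ => 0) j 1)
  rw [tensor_ghz_mulVec, Pi.smul_apply, tensor_mulSingle_mulVec] at e01 e10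
  rw [Finset.prod_eq_zero (Finset.mem_univ j) (i := j) (f := fun k =>
      (Function.update g j 1 k).1 (Function.update (fun _ => (1 : Fin 2)) j 0 k) 1) (by simp)] at e01
  rw [Finset.prod_eq_zero (Finset.mem_univ j) (i := j) (f := fun k =>
      (Function.update g j 1 k).1 (Function.update (fun _ => (0 : Fin 2)) j 1 k) 0) (by simp)] at e10
  simp only [Function.update_idem, hupd, Function.update_self, Fin.sum_univ_two] at e01 e10
  simp only [Fin.isValue, zero_ne_one, one_ne_zero, if_true, if_false, mul_zero, zero_add,
    add_zero, smul_eq_mul] at e01 e10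
  have hQ : ‖∏ k, (Function.update g j 1 k).1 (Function.update (fun _ => (1 : Fin 2)) j 0 k) 0‖ =
      ‖∏ k, (Function.update g j 1 k).1 (Function.update (fun _ => (0 : Fin 2)) j 1 k) 1‖ := by
    rw [norm_prod, norm_prod]
    congr 1
    funext k
    by_cases hk : k = j
    · subst hk; simp
    · simp only [Function.update_of_ne hk]
      exact (U2.norm_offdiag (g k)).symm
  have n01 := congrArg norm e01
  have n10 := congrArg norm e10
  rw [norm_mul, norm_mul, norm_mul, hc1, one_mul] at n01 n10
  rw [hQ, U2.norm_offdiag] at n01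
  set q := ‖∏ k, (Function.update g j 1 k).1 (Function.update (fun _ => (0 : Fin 2)) j 1 k) 1‖
  set s := ‖((g j)⁻¹).1 1 0‖ with hs
  have hs0 : s = 0 := by
    have h1 : (‖a‖ - ‖b‖) * (‖a‖ + ‖b‖) * s = 0 := by
      linear_combination ‖b‖ * n01 - ‖a‖ * n10
    have h2 : ‖a‖ + ‖b‖ ≠ 0 := by
      intro h
      apply hab
      linarith [norm_nonneg a, norm_nonneg b]
    exact (mul_eq_zero.mp h1).resolve_left (mul_ne_zero (sub_ne_zero.mpr hab) h2)
  rw [hs, norm_eq_zero, Matrix.UnitaryGroup.inv_val, Matrix.star_apply, star_eq_zero] at hs0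
  exact (U2.offdiag_eq_zero_iff _).mp hs0

theorem stabilizerIso_genGHZ (hn : 2 ≤ n) {a b : ℂ} (ha : a ≠ 0) (hb : b ≠ 0)
    (hab : ‖a‖ ≠ ‖b‖) :
    StabilizerIso (Fin (n - 1) → Circle) (fun (t : Fin (n - 1) → ℝ) k => Circle.exp (t k))
      (fun t => rotBalanced t) (proj (ghzKet n a b)) := by
  refine stabilizerIso_of_hom ((torusHom n).comp (balancedHom n))
    ((torusHom_injective n).comp (balancedHom_injective n)) (fun U => ?_)
    torusHom_balancedHom_exp
  rw [exists_balanced_torusHom_iff (by omega) ha hb, iff_self_and]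
  intro hU
  obtain ⟨g, rfl⟩ := exists_toLU U
  exact exists_torusHom (offdiag_of_mem_stab_ghz hn hab hU)

/-- On three or more qubits, the factors of a stabilizer element are all diagonal or all
antidiagonal. The third qubit serves to separate the two branches of the state. -/
theorem diag_mul_offdiag_of_mem_stab_ghz (hn : 3 ≤ n) {a b : ℂ} (ha : a ≠ 0) {g : Fin n → U2}
    (hg : toLU g ∈ stab (proj (ghzKet n a b))) {j k : Fin n} (hjk : j ≠ k) :
    (g j).1 0 0 = 0 ∨ (g k).1 1 0 = 0 := by
  obtain ⟨c, -, hc⟩ := (toLU_mem_stab _ _).mp hg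
  obtain ⟨l, hl⟩ : ∃ l : Fin n, l ∉ ({j, k} : Finset (Fin n)) := by
    by_contra! h
    have h1 := Finset.card_le_card (fun x _ => h x : Finset.univ ⊆ ({j, k} : Finset (Fin n)))
    rw [Finset.card_univ, Fintype.card_fin] at h1
    have := h1.trans Finset.card_le_two
    omega
  simp only [Finset.mem_insert, Finset.mem_singleton, not_or] at hl
  have hsplit : g = (fun i => if i = j ∨ i = k then 1 else g i) *
      fun i => if i = j ∨ i = k then g i else 1 := by
    funext i
    by_cases hi : i = j ∨ i = k <;> simp [hi]
  rw [hsplit] at hc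
  have e := congrFun (mulVec_eq_of_mul hc) (Pi.single k 1)
  have p1 : ∏ i, (if i = j ∨ i = k then g i else 1 : U2).1 ((Pi.single k 1 : Fin n → Fin 2) i) 1
      = 0 := Finset.prod_eq_zero (Finset.mem_univ l) (by simp [hl])
  have p2 : ∏ i, ((if i = j ∨ i = k then 1 else g i : U2)⁻¹).1
      ((Pi.single k 1 : Fin n → Fin 2) i) 0 = 0 :=
    Finset.prod_eq_zero (Finset.mem_univ k) (by simp)
  have p3 : ∏ i, ((if i = j ∨ i = k then 1 else g i : U2)⁻¹).1
      ((Pi.single k 1 : Fin n → Fin 2) i) 1 = 0 :=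
    Finset.prod_eq_zero (Finset.mem_univ j) (by simp [hjk])
  rw [tensor_ghz_mulVec, Pi.smul_apply, tensor_ghz_mulVec] at e
  simp only [Pi.inv_apply, p1, p2, p3, mul_zero, add_zero, smul_zero] at e
  have h0 := (mul_eq_zero.mp e).resolve_left ha
  rw [Finset.prod_eq_zero_iff] at h0
  obtain ⟨i, -, hi⟩ := h0
  by_cases hij : i = j
  · subst hij
    left
    simpa [hjk] using hi
  by_cases hik : i = k
  · subst hik
    right
    simpa using hi
  · simp [hij, hik] at hi

theorem stabilizerIso_ghz (hn : 3 ≤ n) {a : ℂ} (ha : a ≠ 0) :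
    StabilizerIso (Dih (Fin (n - 1) → Circle))
      (fun p : (Fin (n - 1) → ℝ) × Z2 => ⟨fun k => Circle.exp (p.1 k), p.2⟩)
      (fun p => rotBalanced p.1 * flipAll n ^ bit p.2) (proj (ghzKet n a a)) := by
  have hflip : flipAll n ∈ stab (proj (ghzKet n a a)) :=
    (toLU_mem_stab _ _).mpr ⟨1, by simp, by rw [flip_ghz, one_smul]⟩
  refine stabilizerIso_of_hom (dihHom ((torusHom n).comp (balancedHom n)) (flipAll n)
    (flipAll_mul_self n) fun w => flipAll_torusHom _) ?_ (fun U => ?_) ?_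
  · exact dihHom_injective _ _ _ _ ((torusHom_injective n).comp (balancedHom_injective n))
      fun w => torusHom_ne_flipAll (by omega) _
  · rw [exists_dihHom_iff, exists_balanced_torusHom_iff (by omega) ha ha,
      exists_balanced_torusHom_iff (by omega) ha ha, Subgroup.mul_mem_cancel_right _ hflip,
      ← and_or_left, iff_self_and]
    intro hU
    obtain ⟨g, rfl⟩ := exists_toLU U
    by_cases hall : ∀ j, (g j).1 0 0 = 0
    · exact Or.inr (exists_torusHom_flip hall)
    · push Not at hall
      obtain ⟨j, hj⟩ := hall
      left
      have hoff : ∀ k, k ≠ j → (g k).1 1 0 = 0 := fun k hk =>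
        (diag_mul_offdiag_of_mem_stab_ghz hn ha hU hk.symm).resolve_left hj
      refine exists_torusHom fun k => ?_
      by_cases hk : k = j
      · subst hk
        obtain ⟨l, hl⟩ : ∃ l : Fin n, l ≠ k := by
          have : Nontrivial (Fin n) := Fin.nontrivial_iff_two_le.mpr (by omega)
          exact exists_ne k
        exact (diag_mul_offdiag_of_mem_stab_ghz hn ha hU hl).resolve_left
          (U2.diag_ne_zero (hoff l hl))
      · exact hoff k hk
  · intro p
    rw [dihHom_apply, MonoidHom.comp_apply, torusHom_balancedHom_exp]

/-! ### The stabilizer of the singlet -/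

/-- The diagonal embedding `g ↦ (g, …, g)`. -/
def constHom (n : ℕ) : PU2 →* LU n where
  toFun g := fun _ => g
  map_one' := rfl
  map_mul' _ _ := rfl

theorem tensor_const_singlet (g : U2) : tensor (fun _ => g) *ᵥ singletKet =
    (g.1 0 0 * g.1 1 1 - g.1 0 1 * g.1 1 0) • singletKet := by
  have h : (fun _ => g : Fin 2 → U2) = Pi.mulSingle 0 g * Pi.mulSingle 1 g := by
    funext k
    fin_cases k <;> simp
  rw [h, tensor_mul_mulVec]
  funext I
  rw [tensor_mulSingle_mulVec, Fin.sum_univ_two, tensor_mulSingle_mulVec, tensor_mulSingle_mulVec,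
    Fin.sum_univ_two, Fin.sum_univ_two, Pi.smul_apply]
  simp only [singletKet_apply]
  rcases bits_two I with rfl | rfl | rfl | rfl <;> simp <;> ring

theorem U2.norm_det (g : U2) : ‖g.1 0 0 * g.1 1 1 - g.1 0 1 * g.1 1 0‖ = 1 := by
  have h := Matrix.det_of_mem_unitary g.2
  rw [Matrix.det_fin_two] at h
  exact CStarRing.norm_of_mem_unitary h

theorem stabilizerIso_singlet :
    StabilizerIso PU2 (fun g : PU2 => g) (fun g _ => g) (proj singletKet) := by
  have hconst : ∀ g : U2, toLU (fun _ => g) ∈ stab (proj singletKet) := fun g =>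
    (toLU_mem_stab _ _).mpr ⟨_, U2.norm_det g, tensor_const_singlet g⟩
  refine stabilizerIso_of_hom (constHom 2) (fun g h hgh => congrFun hgh 0) (fun U => ⟨?_, ?_⟩)
    fun _ => rfl
  · intro hU
    obtain ⟨g, rfl⟩ := exists_toLU U
    refine ⟨QuotientGroup.mk (g 0), ?_⟩
    have h1 := (stab _).mul_mem ((stab _).inv_mem (hconst (g 0))) hU
    rw [← toLU_inv, ← toLU_mul] at h1
    have h2 : (fun _ => g 0 : Fin 2 → U2)⁻¹ * g = Pi.mulSingle 1 ((g 0)⁻¹ * g 1) := by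
      funext k
      fin_cases k <;> simp
    rw [h2] at h1
    obtain ⟨c, -, hc⟩ := (toLU_mem_stab _ _).mp h1
    have hk : (g 0)⁻¹ * g 1 ∈ phases := by
      rw [mem_phases_iff]
      generalize (g 0)⁻¹ * g 1 = k at *
      have hs2 : ((√2 : ℝ) : ℂ) ≠ 0 := by simp
      have e : ∀ I, ∑ x, k.1 (I 1) x * singletKet (Function.update I 1 x) = c * singletKet I := by
        intro I
        have := congrFun hc I
        rwa [tensor_mulSingle_mulVec] at this
      have e11 := e ![1, 1]
      have e01 := e ![0, 1]
      have e10 := e ![1, 0]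
      simp [singletKet_apply] at e11 e01 e10
      exact ⟨e11, e10.trans e01.symm⟩
    funext k
    fin_cases k
    · rfl
    · exact QuotientGroup.eq.mpr hk
  · rintro ⟨z, rfl⟩
    obtain ⟨g, rfl⟩ := QuotientGroup.mk_surjective z
    exact hconst g

/-! ### The stabilizer of a Dicke state -/

theorem wt_update (I : Fin n → Fin 2) (j : Fin n) (x : Fin 2) :
    wt (Function.update I j x) + I j = wt I + x := by
  rw [wt, wt, ← Finset.add_sum_erase _ _ (Finset.mem_univ j),
    ← Finset.add_sum_erase _ (fun k => (I k : ℕ)) (Finset.mem_univ j), Function.update_self,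
    Finset.sum_congr rfl fun k hk => by rw [Function.update_of_ne (Finset.ne_of_mem_erase hk)]]
  ring

theorem exists_bits_of_wt {i j : Fin n} {w : ℕ} (hw : w + 2 ≤ n) :
    ∃ I : Fin n → Fin 2, I i = 0 ∧ I j = 0 ∧ wt I = w := by
  obtain ⟨s, hs, hc⟩ := Finset.exists_subset_card_eq
    (s := (Finset.univ : Finset (Fin n)) \ {i, j}) (n := w) (by
      have h1 := Finset.le_card_sdiff ({i, j} : Finset (Fin n)) Finset.univ
      rw [Finset.card_univ, Fintype.card_fin] at h1
      have := Finset.card_le_two (a := i) (b := j)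
      omega)
  have hi : i ∉ s := fun h => by simpa using hs h
  have hj : j ∉ s := fun h => by simpa using hs h
  refine ⟨fun k => if k ∈ s then 1 else 0, by simp [hi], by simp [hj], ?_⟩
  rw [wt_eq_card]
  simpa using hc

theorem phase_of_mulSingle_dicke {k : ℕ} (hn : 3 ≤ n) (hk0 : 0 < k) (hkn : k < n) {i j : Fin n}
    (hij : i ≠ j) {h : U2}
    (heq : tensor (Pi.mulSingle i h) *ᵥ dickeKet n k = tensor (Pi.mulSingle j h) *ᵥ dickeKet n k) :
    h ∈ phases := by
  -- Compare amplitudes at a bit string with bits `0, 1` at `i, j` and weight `w` elsewhere.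
  have key : ∀ w, w + 2 ≤ n →
      (if w + 1 = k then h.1 0 0 else 0) + (if w + 2 = k then h.1 0 1 else 0) =
        (if w = k then h.1 1 0 else 0) + (if w + 1 = k then h.1 1 1 else 0) := by
    intro w hw
    obtain ⟨I, hi, hj, hI⟩ := exists_bits_of_wt (i := i) (j := j) hw
    have e := congrFun heq (Function.update I j 1)
    have w1 : ∀ x, wt (Function.update (Function.update I j 1) i x) = w + 1 + x := by
      intro x
      have h1 := wt_update (Function.update I j 1) i x
      have h2 := wt_update I j 1
      rw [Function.update_of_ne hij, hi] at h1
      rw [hj] at h2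
      simp at h1 h2
      omega
    have w2 : ∀ x, wt (Function.update (Function.update I j 1) j x) = w + x := by
      intro x
      have h1 := wt_update I j x
      rw [Function.update_idem]
      rw [hj] at h1
      simp at h1
      omega
    rw [tensor_mulSingle_mulVec, tensor_mulSingle_mulVec] at e
    simp only [dickeKet_apply, w1, w2, Function.update_self, Function.update_of_ne hij, hi,
      Fin.sum_univ_two] at e
    have hs := dicke_amp_ne_zero hkn.le
    generalize ((1 / √(n.choose k : ℝ) : ℝ) : ℂ) = s at *
    apply mul_right_cancel₀ hs
    simp only [add_mul, ite_mul, zero_mul]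
    simpa [mul_ite] using e
  rw [mem_phases_iff]
  constructor
  · by_cases h1 : k + 2 ≤ n
    · have := key k h1
      simpa [eq_comm] using this
    · have := key (k - 2) (by omega)
      rw [if_neg (by omega), if_pos (by omega), if_neg (by omega), if_neg (by omega)] at this
      exact (U2.offdiag_eq_zero_iff h).mp (by simpa using this)
  · have := key (k - 1) (by omega)
    rw [if_pos (by omega), if_neg (by omega), if_neg (by omega), if_pos (by omega)] at this
    simpa using this

/-- The diagonal circle in the torus. -/
noncomputable def torusAll (n : ℕ) : Circle →* LU n where
  toFun z := torusHom n fun _ => z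
  map_one' := map_one (torusHom n)
  map_mul' z w := map_mul (torusHom n) (fun _ => z) fun _ => w

theorem torusAll_apply (z : Circle) : torusAll n z = torusHom n fun _ => z := rfl

theorem torusAll_injective (hn : 1 ≤ n) : Function.Injective (torusAll n) := fun _ _ h =>
  congrFun (torusHom_injective n h) ⟨0, hn⟩

theorem torusAll_exp (t : ℝ) : torusAll n (Circle.exp t) = rotAll n t :=
  torusHom_exp fun _ => t

theorem flipAll_torusAll (z : Circle) :
    flipAll n * torusAll n z = (torusAll n z)⁻¹ * flipAll n := flipAll_torusHom _

theorem torusAll_mem_stab_dicke (n k : ℕ) (z : Circle) :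
    torusAll n z ∈ stab (proj (dickeKet n k)) := by
  rw [torusAll_apply, torusHom_eq_toLU, toLU_mem_stab]
  refine ⟨(z : ℂ) ^ k, by rw [norm_pow, Circle.norm_coe, one_pow], ?_⟩
  funext I
  rw [tensor_torus_mulVec, Finset.prod_pow_eq_pow_sum, Pi.smul_apply, dickeKet_apply, smul_eq_mul]
  split_ifs with h
  · rw [← h]; rfl
  · simp

theorem exists_torusAll {g : U2} (h : g.1 1 0 = 0) :
    ∃ z, torusAll n z = toLU fun _ => g := by
  obtain ⟨z, hz⟩ := exists_torus_of_offdiag h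
  exact ⟨z, funext fun _ => hz⟩

theorem exists_const_of_mem_stab_dicke {k : ℕ} (hn : 3 ≤ n) (hk0 : 0 < k) (hkn : k < n)
    {U : LU n} (hU : U ∈ stab (proj (dickeKet n k))) : ∃ g : U2, U = toLU fun _ => g := by
  obtain ⟨g, rfl⟩ := exists_toLU U
  refine ⟨g ⟨0, by omega⟩, ?_⟩
  funext j
  by_cases hj : ⟨0, by omega⟩ = j
  · rw [← hj]; rfl
  · have h1 := phase_of_mulSingle_dicke hn hk0 hkn hj
      ((ketSym_dicke n k).mulSingle_eq hU hj)
    have h2 := (QuotientGroup.eq_one_iff _).mpr h1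
    rw [QuotientGroup.mk_mul, QuotientGroup.mk_inv, mul_inv_eq_one] at h2
    exact h2

/-- The amplitude of `(g ⊗ ⋯ ⊗ g) |D_n^{(k)}⟩` at `|0⋯0⟩`, which must vanish, is a nonzero
multiple of `g₀₀^(n-k) g₀₁^k`. -/
theorem diag_or_offdiag_of_mem_stab_dicke {k : ℕ} (hk0 : 0 < k) (hkn : k < n)
    {g : U2} (hU : toLU (fun _ => g) ∈ stab (proj (dickeKet n k))) :
    g.1 0 0 = 0 ∨ g.1 1 0 = 0 := by
  by_contra! hc
  obtain ⟨h0, h1⟩ := hc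
  rw [Ne, ← U2.offdiag_eq_zero_iff] at h1
  obtain ⟨c, -, hc⟩ := (toLU_mem_stab _ _).mp hU
  have e := congrFun hc 0
  have hw0 : ¬ wt (0 : Fin n → Fin 2) = k := by
    have : wt (0 : Fin n → Fin 2) = 0 := by simp [wt]
    omega
  rw [tensor_mulVec_apply, Pi.smul_apply, dickeKet_apply, if_neg hw0, smul_zero] at e
  simp only [Pi.zero_apply, prod_bits (v := g.1 0) h0, dickeKet_apply, mul_ite, mul_zero] at e
  rw [← Finset.sum_filter, Finset.sum_congr rfl (g := fun _ => g.1 0 0 ^ n * (g.1 0 1 / g.1 0 0) ^ k *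
      ((1 / √(n.choose k : ℝ) : ℝ) : ℂ)) (fun I hI => by rw [(Finset.mem_filter.mp hI).2]),
    Finset.sum_const, card_wt, nsmul_eq_mul] at e
  refine mul_ne_zero ?_ (mul_ne_zero (mul_ne_zero (pow_ne_zero _ h0)
    (pow_ne_zero _ (div_ne_zero h1 h0))) (dicke_amp_ne_zero hkn.le)) e
  exact_mod_cast (Nat.choose_pos hkn.le).ne'

theorem stabilizerIso_dicke {k : ℕ} (hn : 3 ≤ n) (hk0 : 0 < k) (hkn : k < n) (h2k : 2 * k ≠ n) :
    StabilizerIso Circle (fun t : ℝ => Circle.exp t) (fun t => rotAll n t)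
      (proj (dickeKet n k)) := by
  refine stabilizerIso_of_hom (torusAll n) (torusAll_injective (by omega)) (fun U => ⟨?_, ?_⟩)
    torusAll_exp
  · intro hU
    obtain ⟨g, rfl⟩ := exists_const_of_mem_stab_dicke hn hk0 hkn hU
    rcases diag_or_offdiag_of_mem_stab_dicke hk0 hkn hU with h | h
    · exfalso
      obtain ⟨c, -, hc⟩ := (toLU_mem_stab _ _).mp hU
      have hsplit : (fun _ => g : Fin n → U2) = (fun _ => g * flipX) * fun _ => flipX := by
        funext l
        simp [mul_assoc, flipX_mul_self]
      have hoff : ∀ l : Fin n, ((fun _ => g * flipX : Fin n → U2) l).1 1 0 = 0 := by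
        intro l
        rw [mul_flipX_val]
        exact (U2.diag_eq_zero_iff g).mp h
      rw [hsplit, tensor_mul_mulVec, flip_dicke hkn.le] at hc
      obtain ⟨I, hI⟩ := exists_wt_eq (Nat.sub_le n k)
      have e := congrFun hc I
      rw [tensor_diag_mulVec hoff, Pi.smul_apply, dickeKet_apply, dickeKet_apply, if_pos hI,
        if_neg (by omega), smul_zero] at e
      refine mul_ne_zero ?_ (dicke_amp_ne_zero (Nat.sub_le n k)) e
      refine Finset.prod_ne_zero_iff.mpr fun l _ => ?_
      rw [← norm_ne_zero_iff, U2.norm_diag_of_offdiag (hoff l)]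
      exact one_ne_zero
    · exact exists_torusAll h
  · rintro ⟨z, rfl⟩
    exact torusAll_mem_stab_dicke n k z

theorem stabilizerIso_dickeHalf (hn : 4 ≤ n) (he : Even n) :
    StabilizerIso (Dih Circle) (fun p : ℝ × Z2 => ⟨Circle.exp p.1, p.2⟩)
      (fun p => rotAll n p.1 * flipAll n ^ bit p.2) (proj (dickeKet n (n / 2))) := by
  have hhalf : n - n / 2 = n / 2 := by
    obtain ⟨m, rfl⟩ := he
    omega
  have hflip : flipAll n ∈ stab (proj (dickeKet n (n / 2))) :=
    (toLU_mem_stab _ _).mpr ⟨1, by simp, by rw [flip_dicke (Nat.div_le_self n 2), hhalf, one_smul]⟩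
  refine stabilizerIso_of_hom (dihHom (torusAll n) (flipAll n) (flipAll_mul_self n)
    flipAll_torusAll) ?_ (fun U => ?_) ?_
  · exact dihHom_injective _ _ _ _ (torusAll_injective (by omega))
      fun z => torusHom_ne_flipAll (by omega) _
  · rw [exists_dihHom_iff]
    constructor
    · intro hU
      obtain ⟨g, rfl⟩ := exists_const_of_mem_stab_dicke (by omega) (by omega) (by omega) hU
      rcases diag_or_offdiag_of_mem_stab_dicke (by omega) (by omega) hU with h | h
      · right
        rw [flipAll, ← toLU_mul]
        apply exists_torusAll (g := g * flipX)
        rw [mul_flipX_val]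
        exact (U2.diag_eq_zero_iff g).mp h
      · exact Or.inl (exists_torusAll h)
    · rintro (⟨z, rfl⟩ | ⟨z, hz⟩)
      · exact torusAll_mem_stab_dicke n _ z
      · rw [← Subgroup.mul_mem_cancel_right _ hflip, ← hz]
        exact torusAll_mem_stab_dicke n _ z
  · intro p
    rw [dihHom_apply, torusAll_exp]

/-! ### The stabilizer determines the kind of the state -/

/-- The number of solutions of `x ^ 3 = 1`. Three is the least exponent that sees the rank of a
torus and no reflection of its dihedral extension. -/
noncomputable def cubeRoots (G : Type) [Group G] : ℕ := Nat.card {x : G // x ^ 3 = 1}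

theorem cubeRoots_congr {G H : Type} [Group G] [Group H] (e : G ≃* H) :
    cubeRoots G = cubeRoots H :=
  Nat.card_congr (e.toEquiv.subtypeEquiv fun x => by
    show x ^ 3 = 1 ↔ (e x) ^ 3 = 1
    rw [← map_pow, EmbeddingLike.map_eq_one_iff])

theorem cubeRoots_circle : cubeRoots Circle = 3 := by
  have e : {z : Circle // z ^ 3 = 1} ≃ rootsOfUnity 3 Circle :=
    (toUnits (G := Circle)).toEquiv.subtypeEquiv fun z => by
      show z ^ 3 = 1 ↔ toUnits z ∈ rootsOfUnity 3 Circle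
      rw [_root_.mem_rootsOfUnity, ← map_pow, EmbeddingLike.map_eq_one_iff]
  rw [cubeRoots, Nat.card_congr (e.trans (rootsOfUnityCircleEquiv 3).toEquiv)]
  exact Complex.card_rootsOfUnity 3

theorem cubeRoots_torus (m : ℕ) : cubeRoots (Fin m → Circle) = 3 ^ m := by
  have e : {z : Fin m → Circle // z ^ 3 = 1} ≃ (Fin m → {z : Circle // z ^ 3 = 1}) :=
    (Equiv.subtypeEquivRight fun z => by
      show z ^ 3 = 1 ↔ ∀ k, (z k) ^ 3 = 1
      rw [funext_iff]; rfl).trans Equiv.subtypePiEquivPi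
  rw [cubeRoots, Nat.card_congr e, Nat.card_fun, Nat.card_eq_fintype_card (α := Fin m),
    Fintype.card_fin]
  exact congrArg (· ^ m) cubeRoots_circle

theorem cubeRoots_dih (A : Type) [CommGroup A] : cubeRoots (Dih A) = cubeRoots A := by
  symm
  refine Nat.card_congr (Equiv.ofBijective
    (fun a => ⟨SemidirectProduct.inl a.1, by rw [← map_pow, a.2, map_one]⟩) ⟨?_, ?_⟩)
  · intro a b h
    exact Subtype.ext (SemidirectProduct.inl_injective (congrArg Subtype.val h))
  · rintro ⟨⟨a, b⟩, h⟩
    have hb : b = 1 := by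
      have := congrArg SemidirectProduct.rightHom h
      rw [map_pow, map_one] at this
      change b ^ 3 = 1 at this
      have h3 : ∀ b : Z2, b ^ 3 = 1 → b = 1 := by decide
      exact h3 b this
    subst hb
    refine ⟨⟨a, ?_⟩, rfl⟩
    apply SemidirectProduct.inl_injective (φ := invAction A)
    rw [map_pow, map_one]
    exact h

theorem exists_circle_ne_inv : ∃ z : Circle, z ≠ z⁻¹ := by
  refine ⟨⟨Complex.I, mem_sphere_zero_iff_norm.mpr (by simp)⟩, fun h => ?_⟩
  have h1 : Complex.I = Complex.I⁻¹ := (congrArg (fun z : Circle => (z : ℂ)) h).trans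
    (Circle.coe_inv _)
  rw [Complex.inv_I] at h1
  have := congrArg Complex.im h1
  norm_num at this

theorem dih_not_comm {A : Type} [CommGroup A] {a : A} (ha : a ≠ a⁻¹) :
    ¬ ∀ x y : Dih A, x * y = y * x := by
  intro h
  have h1 := congrArg SemidirectProduct.left
    (h (SemidirectProduct.inl a) (SemidirectProduct.inr (Multiplicative.ofAdd 1)))
  have h3 : (Multiplicative.ofAdd 1 : Z2) ≠ 1 := by decide
  rw [SemidirectProduct.mul_left, SemidirectProduct.mul_left] at h1
  simp only [SemidirectProduct.left_inl, SemidirectProduct.right_inl, SemidirectProduct.left_inr,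
    SemidirectProduct.right_inr, map_one, mul_one, one_mul] at h1
  exact ha (h1.trans (by simp [invAction, h3]))

theorem PU2_not_comm : ¬ ∀ x y : PU2, x * y = y * x := by
  intro h
  obtain ⟨z, hz⟩ := exists_circle_ne_inv
  apply hz
  apply torus_injective
  have h1 := flipX_torus z
  rw [h, ← map_inv] at h1
  exact mul_right_cancel h1

/-- The group-theoretic features of the stabilizer that separate the six kinds on `n` qubits. -/
def Profile (n : ℕ) (G : Type) [Group G] : Family → Prop
  | .product => (∀ x y : G, x * y = y * x) ∧ cubeRoots G = 3 ^ n
  | .ghz => 3 ≤ n ∧ (¬ ∀ x y : G, x * y = y * x) ∧ cubeRoots G = 3 ^ (n - 1)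
  | .genGHZ => 2 ≤ n ∧ (∀ x y : G, x * y = y * x) ∧ cubeRoots G = 3 ^ (n - 1)
  | .singlet => n = 2 ∧ ¬ ∀ x y : G, x * y = y * x
  | .dickeHalf => 4 ≤ n ∧ (¬ ∀ x y : G, x * y = y * x) ∧ cubeRoots G = 3 ^ 1
  | .dicke => 3 ≤ n ∧ (∀ x y : G, x * y = y * x) ∧ cubeRoots G = 3 ^ 1

theorem comm_congr {G H : Type} [Group G] [Group H] (e : G ≃* H) :
    (∀ x y : G, x * y = y * x) ↔ ∀ x y : H, x * y = y * x := by
  constructor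
  · intro h x y
    apply e.symm.injective
    rw [map_mul, map_mul, h]
  · intro h x y
    apply e.injective
    rw [map_mul, map_mul, h]

theorem Profile.congr {G H : Type} [Group G] [Group H] (e : G ≃* H) {F : Family}
    (h : Profile n G F) : Profile n H F := by
  cases F <;> simpa only [Profile, ← comm_congr e, ← cubeRoots_congr e] using h

theorem Profile.eq {G : Type} [Group G] {F F' : Family} (h : Profile n G F)
    (h' : Profile n G F') : F = F' := by
  have hinj : ∀ {a b : ℕ}, cubeRoots G = 3 ^ a → cubeRoots G = 3 ^ b → a = b := fun ha hb =>
    Nat.pow_right_injective (a := 3) (by norm_num) (ha.symm.trans hb)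
  cases F <;> cases F' <;> simp only [Profile] at h h' <;> first
    | rfl
    | exact absurd h.2.1 h'.2.1
    | exact absurd h'.2.1 h.2.1
    | exact absurd h.1 h'.2.1
    | exact absurd h'.1 h.2.1
    | exact absurd h.1 h'.2
    | exact absurd h'.1 h.2
    | exact absurd h.2.1 h'.2
    | exact absurd h'.2.1 h.2
    | (exfalso; have := hinj h.2 h'.2.2; omega)
    | (exfalso; have := hinj h.2.2 h'.2; omega)
    | (exfalso; have := hinj h.2.2 h'.2.2; omega)
    | (exfalso; omega)

theorem StabilizerIso.profile {G P : Type} [Group G] {param : P → G} {img : P → LU n}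
    {τ ρ : QMatrix n} {F : Family} (hiso : StabilizerIso G param img τ) (hequiv : LUEquiv τ ρ)
    (h : Profile n G F) : Profile n (stab ρ) F := by
  obtain ⟨U, rfl⟩ := hequiv
  obtain ⟨e, -, he⟩ := hiso
  obtain ⟨e', -⟩ := he U
  exact h.congr e'

theorem OfFamily.profile {ρ : QMatrix n} {F : Family} (h : OfFamily F ρ) :
    Profile n (stab ρ) F := by
  obtain ⟨τ, hτ, hρ⟩ := h
  obtain ⟨z, hz⟩ := exists_circle_ne_inv
  have hz' : ∀ m, 1 ≤ m → (fun _ => z : Fin m → Circle) ≠ (fun _ => z)⁻¹ := fun m hm h =>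
    hz (congrFun h ⟨0, hm⟩)
  cases F
  case product =>
    obtain rfl := hτ
    exact (stabilizerIso_product n).profile hρ ⟨mul_comm, cubeRoots_torus n⟩
  case ghz =>
    obtain ⟨hn, rfl⟩ := hτ
    have ha : ((1 / √2 : ℝ) : ℂ) ≠ 0 := by simp
    exact (stabilizerIso_ghz hn ha).profile hρ
      ⟨hn, dih_not_comm (hz' _ (by omega)), by rw [cubeRoots_dih, cubeRoots_torus]⟩
  case genGHZ =>
    obtain ⟨hn, a, b, ha, hb, hab, -, rfl⟩ := hτ
    exact (stabilizerIso_genGHZ hn ha hb hab).profile hρ ⟨hn, mul_comm, cubeRoots_torus _⟩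
  case singlet =>
    match n, τ, ρ, hτ, hρ with
    | 2, _, ρ, rfl, hρ => exact stabilizerIso_singlet.profile hρ ⟨rfl, PU2_not_comm⟩
  case dickeHalf =>
    obtain ⟨hn, he, rfl⟩ := hτ
    exact (stabilizerIso_dickeHalf hn he).profile hρ
      ⟨hn, dih_not_comm hz, by rw [cubeRoots_dih, cubeRoots_circle, pow_one]⟩
  case dicke =>
    obtain ⟨hn, k, hk0, hkn, h2k, rfl⟩ := hτ
    exact (stabilizerIso_dicke hn hk0 hkn h2k).profile hρ
      ⟨hn, mul_comm, by rw [cubeRoots_circle, pow_one]⟩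

/-! ### Counting local unitary classes -/

theorem luClass_mem_luClasses {ρ : QMatrix n} {F : Family} (hp : IsPure ρ) (hs : IsSymmetric ρ)
    (h : ρ ∈ normalForms n F) : luClass ρ ∈ luClasses n F :=
  ⟨ρ, ⟨hp, hs, ρ, h, LUEquiv.refl ρ⟩, rfl⟩

theorem exists_normalForm_of_mem_luClasses {C : Set (QMatrix n)} {F : Family}
    (h : C ∈ luClasses n F) : ∃ τ ∈ normalForms n F, ∀ σ, LUEquiv τ σ → luClass σ = C := by
  obtain ⟨ρ, ⟨hp, hs, τ, hτ, hρ⟩, rfl⟩ := h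
  exact ⟨τ, hτ, fun σ hσ => (luClass_eq_iff hp hs).mpr (hσ.symm.trans hρ)⟩

theorem ncard_luClasses_eq_one {τ : QMatrix n} {F : Family} (hp : IsPure τ) (hs : IsSymmetric τ)
    (h : normalForms n F = {τ}) : (luClasses n F).ncard = 1 := by
  rw [Set.ncard_eq_one]
  refine ⟨luClass τ, Set.eq_singleton_iff_unique_mem.mpr
    ⟨luClass_mem_luClasses hp hs (h ▸ rfl), fun C hC => ?_⟩⟩
  obtain ⟨σ, hσ, hC⟩ := exists_normalForm_of_mem_luClasses hC
  rw [h] at hσ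
  obtain rfl := hσ
  exact (hC σ (LUEquiv.refl σ)).symm

theorem isSymmetric_singlet : IsSymmetric (proj singletKet) := by
  intro π
  have h : ∃ c : ℂ, ‖c‖ = 1 ∧ (fun I => singletKet (I ∘ π)) = c • singletKet := by
    have hπ : ∀ π : Equiv.Perm (Fin 2), π = 1 ∨ π = Equiv.swap 0 1 := by decide
    rcases hπ π with rfl | rfl
    · exact ⟨1, by simp, by rw [one_smul]; rfl⟩
    · refine ⟨-1, by simp, ?_⟩
      funext I
      rw [Pi.smul_apply, singletKet_apply, singletKet_apply]
      simp only [Function.comp_apply, Equiv.swap_apply_left, Equiv.swap_apply_right]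
      rcases bits_two I with rfl | rfl | rfl | rfl <;> simp
  obtain ⟨c, hc1, hc⟩ := h
  have h2 : (proj singletKet).submatrix (fun I => I ∘ π) (fun I => I ∘ π) =
      proj (fun I => singletKet (I ∘ π)) := rfl
  rw [h2, hc, proj_smul hc1]

/-! ### The probability of reading `0` on one qubit -/

/-- The unnormalised state vector after reading `0` on the qubit `j`. -/
def readZero (j : Fin n) (ψ : Ket n) : Ket n := fun I => if I j = 0 then ψ I else 0

/-- The probability of reading `0` on the qubit `j`. -/
noncomputable def probZero (j : Fin n) (ψ : Ket n) : ℝ := ∑ I, ‖readZero j ψ I‖ ^ 2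

/-- Of two bit strings that differ only at `j`, at most one has nonzero amplitude. This is a
sufficient condition for the reduced state of the qubit `j` to be diagonal. -/
def DiagAt (j : Fin n) (ψ : Ket n) : Prop :=
  ∀ I, ψ (Function.update I j 0) = 0 ∨ ψ (Function.update I j 1) = 0

theorem probZero_eq (j : Fin n) (ψ : Ket n) :
    probZero j ψ = ∑ I with I j = 0, ‖ψ I‖ ^ 2 := by
  rw [probZero, Finset.sum_filter]
  congr 1
  funext I
  rw [readZero]
  split_ifs <;> simp

theorem readZero_mulVec {g : Fin n → U2} {j : Fin n} (hg : g j = 1) (ψ : Ket n) :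
    readZero j (tensor g *ᵥ ψ) = tensor g *ᵥ readZero j ψ := by
  funext I
  rw [readZero, tensor_mulVec_apply, tensor_mulVec_apply]
  have hz : ∀ J : Fin n → Fin 2, J j ≠ I j → ∏ k, (g k).1 (I k) (J k) = 0 := fun J hJ =>
    Finset.prod_eq_zero (Finset.mem_univ j) (by
      rw [hg, Matrix.UnitaryGroup.one_val, Matrix.one_apply_ne hJ.symm])
  split_ifs with hI
  · congr 1
    funext J
    by_cases hJ : J j = I j
    · rw [readZero, if_pos (hJ.trans hI)]
    · rw [hz J hJ, zero_mul, zero_mul]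
  · symm
    apply Finset.sum_eq_zero
    intro J _
    by_cases hJ : J j = I j
    · rw [readZero, if_neg (fun h => hI (hJ.symm.trans h)), mul_zero]
    · rw [hz J hJ, zero_mul]

theorem sum_norm_sq_mulVec (g : Fin n → U2) (ψ : Ket n) :
    ∑ I, ‖(tensor g *ᵥ ψ) I‖ ^ 2 = ∑ I, ‖ψ I‖ ^ 2 := by
  have := trace_proj_mulVec g ψ
  rw [trace_proj, trace_proj] at this
  exact_mod_cast this

theorem probZero_mulVec_of_eq_one {g : Fin n → U2} {j : Fin n} (hg : g j = 1) (ψ : Ket n) :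
    probZero j (tensor g *ᵥ ψ) = probZero j ψ := by
  rw [probZero, readZero_mulVec hg, sum_norm_sq_mulVec, probZero]

theorem probZero_smul {c : ℂ} (hc : ‖c‖ = 1) (j : Fin n) (ψ : Ket n) :
    probZero j (c • ψ) = probZero j ψ := by
  rw [probZero_eq, probZero_eq]
  congr 1
  funext I
  rw [Pi.smul_apply, norm_smul, hc, one_mul]

theorem sum_update_one (j : Fin n) (ψ : Ket n) :
    ∑ I with I j = 0, ‖ψ (Function.update I j 1)‖ ^ 2 = ∑ I with ¬ I j = 0, ‖ψ I‖ ^ 2 := by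
  refine Finset.sum_nbij' (fun I => Function.update I j 1) (fun I => Function.update I j 0)
    ?_ ?_ ?_ ?_ ?_
  · intro I _
    simp
  · intro I _
    simp
  · intro I hI
    rw [Function.update_idem, ← (Finset.mem_filter.mp hI).2, Function.update_eq_self]
  · intro I hI
    have h : I j = 1 := by
      have := (Finset.mem_filter.mp hI).2
      generalize I j = x at *
      fin_cases x <;> simp_all
    rw [Function.update_idem, ← h, Function.update_eq_self]
  · intro I _
    rfl

/-- The probability transforms like the diagonal entries of `g_j D g_j†` with `D` the reduced
state: a convex combination of the old probabilities. -/
theorem probZero_mulVec {j : Fin n} {ψ : Ket n} (hd : DiagAt j ψ) (ht : (proj ψ).trace = 1)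
    (g : Fin n → U2) : probZero j (tensor g *ᵥ ψ) =
      ‖(g j).1 0 0‖ ^ 2 * probZero j ψ + ‖(g j).1 0 1‖ ^ 2 * (1 - probZero j ψ) := by
  have hsplit : g = Function.update g j 1 * Pi.mulSingle j (g j) := by
    funext k
    by_cases hk : k = j
    · subst hk; simp
    · simp [hk]
  have hsum : ∑ I with ¬ I j = 0, ‖ψ I‖ ^ 2 = 1 - probZero j ψ := by
    rw [trace_proj_eq_one_iff] at ht
    rw [probZero_eq, ← ht, ← Finset.sum_filter_add_sum_filter_not Finset.univ (fun I => I j = 0)]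
    ring
  conv_lhs => rw [hsplit]
  rw [tensor_mul_mulVec, probZero_mulVec_of_eq_one (by simp), probZero_eq, ← hsum,
    ← sum_update_one, probZero_eq, Finset.mul_sum, Finset.mul_sum, ← Finset.sum_add_distrib]
  refine Finset.sum_congr rfl fun I hI => ?_
  have hI := (Finset.mem_filter.mp hI).2
  have h0 : Function.update I j 0 = I := by
    rw [← hI, Function.update_eq_self]
  rw [tensor_mulSingle_mulVec, Fin.sum_univ_two, h0, hI]
  have hd' := hd I
  rw [h0] at hd'
  rcases hd' with h | h <;> rw [h] <;> simp [mul_pow]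

theorem probZero_le_of_luEquiv {j : Fin n} {ψ φ : Ket n} (hd : DiagAt j ψ)
    (ht : (proj ψ).trace = 1) (hp : 1 / 2 ≤ probZero j ψ) (h : LUEquiv (proj ψ) (proj φ)) :
    probZero j φ ≤ probZero j ψ := by
  obtain ⟨U, hU⟩ := h
  obtain ⟨g, rfl⟩ := exists_toLU U
  obtain ⟨c, hc1, hc⟩ := (act_proj_eq_iff g ψ φ).mp hU
  have h1 := probZero_mulVec hd ht g
  rw [hc, probZero_smul hc1] at h1
  have h2 := U2.normSq_row (g j) 0
  rw [h1]
  nlinarith [sq_nonneg ‖(g j).1 0 1‖]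

/-- The larger eigenvalue of a one-qubit reduced state is an invariant. -/
theorem probZero_eq_of_luEquiv {j : Fin n} {ψ φ : Ket n} (hd : DiagAt j ψ) (hd' : DiagAt j φ)
    (ht : (proj ψ).trace = 1) (ht' : (proj φ).trace = 1) (hp : 1 / 2 ≤ probZero j ψ)
    (hp' : 1 / 2 ≤ probZero j φ) (h : LUEquiv (proj ψ) (proj φ)) :
    probZero j ψ = probZero j φ :=
  le_antisymm (probZero_le_of_luEquiv hd' ht' hp' h.symm) (probZero_le_of_luEquiv hd ht hp h)

/-! ### Classes of generalized GHZ states -/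

theorem diagAt_ghz (hn : 2 ≤ n) (j : Fin n) (a b : ℂ) : DiagAt j (ghzKet n a b) := by
  intro I
  have : Nontrivial (Fin n) := Fin.nontrivial_iff_two_le.mpr hn
  obtain ⟨l, hl⟩ := exists_ne j
  have hne : ∀ x, x ≠ I l → ghzKet n a b (Function.update I j x) = 0 := by
    intro x hx
    have hconst : ∀ y : Fin 2, Function.update I j x ≠ fun _ => y := fun y h => hx (by
      have h1 := congrFun h j
      have h2 := congrFun h l
      rw [Function.update_self] at h1
      rw [Function.update_of_ne hl] at h2
      exact h1.trans h2.symm)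
    have h0 : Function.update I j x ≠ 0 := hconst 0
    have h1 : Function.update I j x ≠ 1 := hconst 1
    simp [ghzKet, h0, h1]
  by_cases h : I l = 0
  · exact Or.inr (hne 1 (by rw [h]; exact one_ne_zero))
  · exact Or.inl (hne 0 (Ne.symm h))

theorem probZero_ghz (hn : 1 ≤ n) (j : Fin n) (a b : ℂ) :
    probZero j (ghzKet n a b) = ‖a‖ ^ 2 := by
  rw [probZero_eq, Finset.sum_eq_single 0]
  · simp [ghzKet, zero_ne_one_bits hn]
  · intro I hI h0
    have h1 : I ≠ 1 := by
      rintro rfl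
      simpa using (Finset.mem_filter.mp hI).2
    simp [ghzKet, h0, h1]
  · simp

theorem exists_real_ghz (hn : 1 ≤ n) {a b : ℂ} (ha : a ≠ 0) (hb : b ≠ 0) (hab : ‖a‖ ≠ ‖b‖)
    (h : ‖a‖ ^ 2 + ‖b‖ ^ 2 = 1) :
    ∃ a' b' : ℝ, 0 < b' ∧ b' < a' ∧ a' ^ 2 + b' ^ 2 = 1 ∧
      LUEquiv (proj (ghzKet n a b)) (proj (ghzKet n (a' : ℂ) (b' : ℂ))) := by
  rcases hab.lt_or_gt with hlt | hlt
  · exact ⟨‖b‖, ‖a‖, norm_pos_iff.mpr ha, hlt, by linarith,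
      (luEquiv_ghz_norm hn a b).trans (luEquiv_ghz_swap _ _)⟩
  · exact ⟨‖a‖, ‖b‖, norm_pos_iff.mpr hb, hlt, h, luEquiv_ghz_norm hn a b⟩

theorem bijOn_genGHZ (hn : 2 ≤ n) :
    Set.BijOn (fun t : ℝ => luClass (proj (ghzKet n
      (Real.cos (Real.pi / 4 * t) : ℂ) (Real.sin (Real.pi / 4 * t) : ℂ))))
      (Set.Ioo 0 1) (luClasses n .genGHZ) := by
  have hpi := Real.pi_pos
  have hangle : ∀ t ∈ Set.Ioo (0 : ℝ) 1, 0 < Real.sin (Real.pi / 4 * t) ∧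
      Real.sin (Real.pi / 4 * t) < Real.cos (Real.pi / 4 * t) := by
    rintro t ⟨h0, h1⟩
    have h2 : 0 < Real.pi / 4 * t := by positivity
    have h3 : Real.pi / 4 * t < Real.pi / 4 := by nlinarith
    refine ⟨Real.sin_pos_of_pos_of_lt_pi h2 (by linarith), ?_⟩
    rw [← Real.cos_pi_div_two_sub]
    exact Real.cos_lt_cos_of_nonneg_of_le_pi h2.le (by linarith) (by linarith)
  have hnorm : ∀ t : ℝ, ‖(Real.cos (Real.pi / 4 * t) : ℂ)‖ ^ 2 +
      ‖(Real.sin (Real.pi / 4 * t) : ℂ)‖ ^ 2 = 1 := by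
    intro t
    rw [Complex.norm_real, Complex.norm_real, Real.norm_eq_abs, Real.norm_eq_abs, sq_abs, sq_abs,
      Real.cos_sq_add_sin_sq]
  have htr := fun t => (trace_proj_ghz (n := n) (by omega)).mpr (hnorm t)
  have hsym : ∀ a b, IsSymmetric (proj (ghzKet n a b)) := fun a b =>
    isSymmetric_proj (ketSym_ghz n a b)
  have j : Fin n := ⟨0, by omega⟩
  refine ⟨?_, ?_, ?_⟩
  · intro t ht
    obtain ⟨h1, h2⟩ := hangle t ht
    refine luClass_mem_luClasses (isPure_proj (htr t)) (hsym _ _)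
      ⟨hn, _, _, ?_, ?_, ?_, hnorm t, rfl⟩
    · exact Complex.ofReal_ne_zero.mpr (h1.trans h2).ne'
    · exact Complex.ofReal_ne_zero.mpr h1.ne'
    · rw [Complex.norm_real, Complex.norm_real, Real.norm_of_nonneg (h1.trans h2).le,
        Real.norm_of_nonneg h1.le]
      exact h2.ne'
  · intro t ht s hs hts
    have hequiv := (luClass_eq_iff (isPure_proj (htr s)) (hsym _ _)).mp hts
    have hhalf : ∀ t ∈ Set.Ioo (0 : ℝ) 1, 1 / 2 ≤ ‖(Real.cos (Real.pi / 4 * t) : ℂ)‖ ^ 2 := by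
      intro t ht
      obtain ⟨h1, h2⟩ := hangle t ht
      have h3 := Real.cos_sq_add_sin_sq (Real.pi / 4 * t)
      rw [Complex.norm_real, Real.norm_eq_abs, sq_abs]
      nlinarith
    have h := probZero_eq_of_luEquiv (diagAt_ghz hn j _ _) (diagAt_ghz hn j _ _) (htr t) (htr s)
      (by rw [probZero_ghz (by omega)]; exact hhalf t ht)
      (by rw [probZero_ghz (by omega)]; exact hhalf s hs) hequiv
    rw [probZero_ghz (by omega), probZero_ghz (by omega), Complex.norm_real, Complex.norm_real,
      Real.norm_eq_abs, Real.norm_eq_abs, sq_abs, sq_abs] at h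
    have hc : Real.cos (Real.pi / 4 * t) = Real.cos (Real.pi / 4 * s) :=
      (pow_left_inj₀ ((hangle t ht).1.trans (hangle t ht).2).le
        ((hangle s hs).1.trans (hangle s hs).2).le two_ne_zero).mp h
    have hI : ∀ t ∈ Set.Ioo (0 : ℝ) 1, Real.pi / 4 * t ∈ Set.Icc 0 Real.pi := by
      rintro t ⟨h0, h1⟩
      exact ⟨by positivity, by nlinarith⟩
    exact mul_left_cancel₀ (by positivity) (Real.injOn_cos (hI t ht) (hI s hs) hc)
  · intro C hC
    obtain ⟨_, ⟨-, a, b, ha, hb, hab, h1, rfl⟩, hC⟩ := exists_normalForm_of_mem_luClasses hC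
    obtain ⟨a', b', hb0, hba, h1', hequiv⟩ := exists_real_ghz (n := n) (by omega) ha hb hab h1
    have ha1 : a' ≤ 1 := by nlinarith
    have hsin : Real.sin (Real.arccos a') = b' := by
      rw [Real.sin_arccos, Real.sqrt_eq_iff_mul_self_eq_of_pos hb0]
      linarith
    have hcos : Real.cos (Real.arccos a') = a' := Real.cos_arccos (by linarith) ha1
    have hlt : Real.arccos a' < Real.pi / 4 := by
      by_contra hc
      push Not at hc
      have h2 := Real.cos_le_cos_of_nonneg_of_le_pi (by positivity) (Real.arccos_le_pi a') hc
      rw [hcos, Real.cos_pi_div_four] at h2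
      have h3 : (√2 : ℝ) ^ 2 = 2 := Real.sq_sqrt (by norm_num)
      nlinarith [Real.sqrt_nonneg 2]
    have hpos : 0 < Real.arccos a' := Real.arccos_pos.mpr (by nlinarith)
    refine ⟨4 / Real.pi * Real.arccos a', ⟨by positivity, ?_⟩, ?_⟩
    · rw [div_mul_eq_mul_div, div_lt_one hpi]
      linarith
    · have he : Real.pi / 4 * (4 / Real.pi * Real.arccos a') = Real.arccos a' := by
        field_simp
      beta_reduce
      rw [he, hcos, hsin]
      exact hC _ hequiv

/-! ### Classes of Dicke states -/

theorem diagAt_dicke (j : Fin n) (k : ℕ) : DiagAt j (dickeKet n k) := by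
  intro I
  have h0 := wt_update I j 0
  have h1 := wt_update I j 1
  rw [dickeKet_apply, dickeKet_apply]
  simp only [Fin.val_zero, Fin.val_one] at h0 h1
  by_cases h : wt (Function.update I j 0) = k
  · right
    rw [if_neg (by omega)]
  · left
    rw [if_neg h]

theorem probZero_comp {ψ : Ket n} (hψ : KetSym ψ) (i j : Fin n) :
    probZero i ψ = probZero j ψ := by
  rw [probZero, probZero,
    ← Equiv.sum_comp (Equiv.arrowCongr (Equiv.swap i j)⁻¹ (Equiv.refl (Fin 2)))]
  congr 1
  funext I
  have : (Equiv.arrowCongr (Equiv.swap i j)⁻¹ (Equiv.refl (Fin 2))) I = I ∘ Equiv.swap i j := rfl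
  rw [this, readZero, readZero, hψ, Function.comp_apply, Equiv.swap_apply_left]

theorem probZero_dicke {k : ℕ} (hk : k ≤ n) (j : Fin n) :
    n * probZero j (dickeKet n k) = n - k := by
  have ht := (trace_proj_eq_one_iff _).mp (trace_proj_dicke hk)
  calc (n : ℝ) * probZero j (dickeKet n k) = ∑ i : Fin n, probZero i (dickeKet n k) := by
        rw [Finset.sum_congr rfl fun i _ => probZero_comp (ketSym_dicke n k) i j,
          Finset.sum_const, Finset.card_univ, Fintype.card_fin, nsmul_eq_mul]
    _ = ∑ I, ∑ i : Fin n, ‖readZero i (dickeKet n k) I‖ ^ 2 := Finset.sum_comm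
    _ = ∑ I, (n - k : ℝ) * ‖dickeKet n k I‖ ^ 2 := by
        congr 1
        funext I
        have h1 : ∀ i, ‖readZero i (dickeKet n k) I‖ ^ 2 =
            (1 - ((I i : ℕ) : ℝ)) * ‖dickeKet n k I‖ ^ 2 := by
          intro i
          rw [readZero]
          generalize I i = x
          fin_cases x <;> simp
        simp only [h1]
        rw [← Finset.sum_mul, Finset.sum_sub_distrib, Finset.sum_const, Finset.card_univ,
          Fintype.card_fin, nsmul_eq_mul, mul_one, ← Nat.cast_sum]
        change ((n : ℝ) - (wt I : ℝ)) * _ = _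
        by_cases hI : wt I = k
        · rw [hI]
        · simp [dickeKet_apply, hI]
    _ = n - k := by rw [← Finset.mul_sum, ht, mul_one]

theorem bijOn_dicke (hn : 3 ≤ n) :
    Set.BijOn (fun k : ℕ => luClass (proj (dickeKet n k)))
      (Set.Icc 1 ((n - 1) / 2)) (luClasses n .dicke) := by
  have hsym : ∀ k, IsSymmetric (proj (dickeKet n k)) := fun k =>
    isSymmetric_proj (ketSym_dicke n k)
  have hn0 : (0 : ℝ) < n := by exact_mod_cast (by omega : 0 < n)
  have j : Fin n := ⟨0, by omega⟩
  refine ⟨?_, ?_, ?_⟩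
  · rintro k ⟨h1, h2⟩
    exact luClass_mem_luClasses (isPure_proj (trace_proj_dicke (by omega))) (hsym k)
      ⟨hn, k, by omega, by omega, by omega, rfl⟩
  · rintro k ⟨hk1, hk2⟩ l ⟨hl1, hl2⟩ hkl
    have htl := trace_proj_dicke (n := n) (k := l) (by omega)
    have hequiv := (luClass_eq_iff (isPure_proj htl) (hsym l)).mp hkl
    have hhalf : ∀ k, 2 * k ≤ n → 1 / 2 ≤ probZero j (dickeKet n k) := by
      intro k hk
      have h1 := probZero_dicke (n := n) (k := k) (by omega) j
      have h2 : (2 : ℝ) * k ≤ n := by exact_mod_cast hk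
      by_contra hc
      push Not at hc
      nlinarith
    have h := probZero_eq_of_luEquiv (diagAt_dicke j k) (diagAt_dicke j l)
      (trace_proj_dicke (by omega)) htl (hhalf k (by omega)) (hhalf l (by omega)) hequiv
    have h1 := probZero_dicke (n := n) (k := k) (by omega) j
    have h2 := probZero_dicke (n := n) (k := l) (by omega) j
    rw [h] at h1
    have : (k : ℝ) = l := by linarith
    exact_mod_cast this
  · intro C hC
    obtain ⟨_, ⟨-, k, hk0, hkn, h2k, rfl⟩, hC⟩ := exists_normalForm_of_mem_luClasses hC
    by_cases hk : k ≤ (n - 1) / 2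
    · exact ⟨k, ⟨hk0, hk⟩, hC _ (LUEquiv.refl _)⟩
    · exact ⟨n - k, ⟨by omega, by omega⟩, hC _ (luEquiv_dicke_flip hkn.le)⟩

theorem ncard_luClasses_dicke (hn : 3 ≤ n) : (luClasses n .dicke).ncard = (n - 1) / 2 := by
  have h := bijOn_dicke hn
  rw [← h.image_eq, h.injOn.ncard_image, ← Finset.coe_Icc, Set.ncard_coe_finset,
    Nat.card_Icc, Nat.add_sub_cancel]

end LUStab

theorem theorem3 :
    -- the classification
    (∀ (n : ℕ) (ρ : QMatrix n), IsPure ρ → IsSymmetric ρ → Infinite (stab ρ) →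
      ∃! F : Family, OfFamily F ρ) ∧
    -- product states
    (∀ n : ℕ, 1 ≤ n →
      StabilizerIso (Fin n → Circle)
        (fun (t : Fin n → ℝ) k => Circle.exp (t k))
        (fun t => rotEach t)
        (proj (productKet n)) ∧
      (luClasses n .product).ncard = 1) ∧
    -- GHZ states
    (∀ n : ℕ, 3 ≤ n →
      StabilizerIso (Dih (Fin (n - 1) → Circle))
        (fun p : (Fin (n - 1) → ℝ) × Z2 => ⟨fun k => Circle.exp (p.1 k), p.2⟩)
        (fun p => rotBalanced p.1 * flipAll n ^ bit p.2)
        (proj (ghzKet n ((1 / √2 : ℝ) : ℂ) ((1 / √2 : ℝ) : ℂ))) ∧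
      (luClasses n .ghz).ncard = 1) ∧
    -- generalized GHZ states
    (∀ n : ℕ, 2 ≤ n →
      (∀ a b : ℂ, a ≠ 0 → b ≠ 0 → ‖a‖ ≠ ‖b‖ → ‖a‖ ^ 2 + ‖b‖ ^ 2 = 1 →
        StabilizerIso (Fin (n - 1) → Circle)
          (fun (t : Fin (n - 1) → ℝ) k => Circle.exp (t k))
          (fun t => rotBalanced t)
          (proj (ghzKet n a b)) ∧
        ∃ a' b' : ℝ, 0 < b' ∧ b' < a' ∧ a' ^ 2 + b' ^ 2 = 1 ∧
          LUEquiv (proj (ghzKet n a b)) (proj (ghzKet n (a' : ℂ) (b' : ℂ)))) ∧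
      Set.BijOn
        (fun t : ℝ => luClass (proj (ghzKet n
          (Real.cos (Real.pi / 4 * t) : ℂ) (Real.sin (Real.pi / 4 * t) : ℂ))))
        (Set.Ioo 0 1) (luClasses n .genGHZ)) ∧
    -- the singlet state
    (StabilizerIso PU2 (fun g : PU2 => g) (fun g _ => g) (proj singletKet) ∧
      (luClasses 2 .singlet).ncard = 1) ∧
    -- balanced Dicke states
    (∀ n : ℕ, 4 ≤ n → Even n →
      StabilizerIso (Dih Circle)
        (fun p : ℝ × Z2 => ⟨Circle.exp p.1, p.2⟩)
        (fun p => rotAll n p.1 * flipAll n ^ bit p.2)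
        (proj (dickeKet n (n / 2))) ∧
      (luClasses n .dickeHalf).ncard = 1) ∧
    -- the other Dicke states
    (∀ n : ℕ, 3 ≤ n →
      (∀ k : ℕ, 0 < k → k < n → 2 * k ≠ n →
        StabilizerIso Circle (fun t : ℝ => Circle.exp t) (fun t => rotAll n t)
          (proj (dickeKet n k))) ∧
      (luClasses n .dicke).ncard = (n - 1) / 2 ∧
      Set.BijOn (fun k : ℕ => luClass (proj (dickeKet n k)))
        (Set.Icc 1 ((n - 1) / 2)) (luClasses n .dicke)) := by
  refine ⟨fun n ρ hp hs hinf => ?_, fun n hn => ⟨stabilizerIso_product n, ?_⟩,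
    fun n hn => ⟨stabilizerIso_ghz hn (by simp), ?_⟩, fun n hn => ⟨fun a b ha hb hab h =>
      ⟨stabilizerIso_genGHZ hn ha hb hab, exists_real_ghz (by omega) ha hb hab h⟩,
      bijOn_genGHZ hn⟩, ⟨stabilizerIso_singlet, ?_⟩,
    fun n hn he => ⟨stabilizerIso_dickeHalf hn he, ?_⟩, fun n hn =>
      ⟨fun k hk0 hkn h2k => stabilizerIso_dicke hn hk0 hkn h2k, ncard_luClasses_dicke hn,
        bijOn_dicke hn⟩⟩
  · obtain ⟨F, hF⟩ := exists_ofFamily hp hs hinf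
    exact ⟨F, hF, fun F' hF' => hF'.profile.eq hF.profile⟩
  · refine ncard_luClasses_eq_one (τ := proj (productKet n)) ?_ ?_ rfl
    · rw [productKet_eq]
      exact isPure_proj ((trace_proj_ghz hn).mpr (by simp))
    · rw [productKet_eq]
      exact isSymmetric_proj (ketSym_ghz n 1 0)
  · refine ncard_luClasses_eq_one
      (τ := proj (ghzKet n ((1 / √2 : ℝ) : ℂ) ((1 / √2 : ℝ) : ℂ))) (isPure_proj ?_)
      (isSymmetric_proj (ketSym_ghz n _ _)) ?_
    · rw [trace_proj_ghz (by omega), Complex.norm_real, Real.norm_of_nonneg (by positivity),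
        div_pow, Real.sq_sqrt (by norm_num)]
      norm_num
    · ext τ
      exact and_iff_right hn
  · exact ncard_luClasses_eq_one (isPure_proj trace_proj_singlet) isSymmetric_singlet rfl
  · refine ncard_luClasses_eq_one (τ := proj (dickeKet n (n / 2)))
      (isPure_proj (trace_proj_dicke (Nat.div_le_self n 2)))
      (isSymmetric_proj (ketSym_dicke n _)) ?_
    ext τ
    exact ⟨fun h => h.2.2, fun h => ⟨hn, he, h⟩⟩
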